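/- Conventions. A signature $\mathbf S$ consists of a first-order vocabulary $S$ together with, for each operation and each predicate symbol, a modulus $\delta:\mathbb Q\cap(0,1)\to\mathbb Q\cap(0,1)$. An $\mathbf S$-structure $M$ is a nonempty metric space $(M,d)$ (not necessarily complete) with $d\le 1$, together with an operation $f^M:M^n\to M$ for each $n$-ary operation symbol $f$ and a function $R^M:M^n\to[0,1]$ for each $n$-ary predicate symbol $R$, such that for every $\epsilon\in\mathbb Q\cap(0,1)$, if $d(a_i,b_i)<\delta(\epsilon)$ for $1\le i\le n$, then $d(f^M(\bar a),f^M(\bar b))\le\epsilon$, respectively $|R^M(\bar a)-R^M(\bar b)|\le\epsilon$, where $\delta$ is the modulus of the symbol. The formulas of basic continuous logic are built from the atomic formulas $d(t_1,t_2)$ and $R(t_1,\dots,t_n)$ ($t_i$ terms) and the constants $r\in\mathbb Q\cap[0,1]$ by means of the Łukasiewicz implication, $(\varphi\to\psi)^M=\min\{1-\varphi^M+\psi^M,1\}$, and the quantifier $\exists$, $(\exists x\,\varphi)^M=\sup_{a\in M}\varphi[a]^M$ (so that $\neg\varphi:=\varphi\to 0$ and $\forall x\,\varphi:=\neg\exists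 x\neg\varphi$, an infimum, are definable). We write $M\models\varphi[\bar a]$ if $\varphi^M[\bar a]=1$, and $\varphi\ge r$ for the formula $r\to\varphi$. A theory is a set of sentences; a structure in which all of them have value $1$ is a model of it. A type $\Sigma(\bar x)$ is a set of formulas in a finite list $\bar x=x_1,\dots,x_n$ of variables; it is realized by $\bar a\in M^n$ if $M\models\sigma[\bar a]$ for all $\sigma\in\Sigma$, and $M$ omits $\Sigma(\bar x)$ if no tuple of $M$ realizes it. For an $S$-theory $T$, $T\cup\Phi(\bar x)\models\Sigma(\bar x)$ means that in every $\mathbf S$-structure that is a model of $T$, every tuple realizing $\Phi(\bar x)$ realizes $\Sigma(\bar x)$. A set of formulas $\Phi(\bar x)$ generates $\Sigma(\bar x)$ over $T$ if $\Phi(\bar x)$ is realized in some $\mathbf S$-structure that is a model of $T$, and $T\cup\Phi(\bar x)\models\Sigma(\bar x)$. For an uncountable cardinal $\lambda$, the type $\Sigma(\bar x)$ is $\lambda$-principal over $T$ if some set of fewer than $\lambda$ formulas $\Phi(\bar x)$ generates $\Sigma(\bar x)$ over $T$. The type $\Sigma(x_1,\dots,x_n)$ is $\omega$-principal over $T$ if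 there are a finite list of variables $\bar y$, terms $t_1(\bar y),\dots,t_n(\bar y)$ and a single formula $\varphi(\bar y)$ such that $\varphi(\bar y)$ generates $\Sigma(t_1(\bar y),\dots,t_n(\bar y))$ over $T$ and $T\cup\{\varphi(\bar y)\ge r\}\models\Sigma(t_1(\bar y),\dots,t_n(\bar y))$ for some $r\in\mathbb Q\cap(0,1)$. Theorem. Basic continuous logic has the $\lambda$-Omitting Types Property for every infinite cardinal $\lambda$. That is: let $\lambda$ be an infinite cardinal, $\mathbf S$ a signature, $T$ an $S$-theory with $|T|\le\lambda$ that is satisfied by some $\mathbf S$-structure, and let $(\Sigma_j)_{j\in J}$, $|J|\le\lambda$, be a family of types, each in a finite list of variables (whose length may depend on $j$), none of which is $\lambda$-principal over $T$. Then some $\mathbf S$-structure is a model of $T$ and omits $\Sigma_j$ for every $j\in J$. -/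

import Mathlib

open Cardinal

universe u

namespace BasicContinuousLogic

/-- A signature: a first-order vocabulary together with a modulus of uniform continuity
`ℚ ∩ (0,1) → ℚ ∩ (0,1)` for each operation symbol and each predicate symbol. -/
structure Signature : Type (u + 1) where
  /-- The vocabulary: `voc.Functions n` are the `n`-ary operation symbols and `voc.Relations n`
  the `n`-ary predicate symbols. -/
  voc : FirstOrder.Language.{u, u}
  /-- Moduli of the operation symbols. -/
  funModulus : ∀ {n : ℕ}, voc.Functions n → Set.Ioo (0 : ℚ) 1 → Set.Ioo (0 : ℚ) 1
  /-- Moduli of the predicate symbols. -/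
  relModulus : ∀ {n : ℕ}, voc.Relations n → Set.Ioo (0 : ℚ) 1 → Set.Ioo (0 : ℚ) 1

/-- Terms in the variables `x₀, …, xₙ₋₁`. -/
abbrev Signature.Term (S : Signature.{u}) (n : ℕ) : Type u := S.voc.Term (Fin n)

/-- A (one-sorted, `[0,1]`-valued) continuous metric structure obeying the moduli of `S`.
It need not be complete. -/
structure MetricStructure (S : Signature.{u}) : Type (u + 1) where
  carrier : Type u
  [metric : MetricSpace carrier]
  [nonempty : Nonempty carrier]
  dist_le_one : ∀ a b : carrier, dist a b ≤ 1
  funMap : ∀ {n : ℕ}, S.voc.Functions n → (Fin n → carrier) → carrier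
  relMap : ∀ {n : ℕ}, S.voc.Relations n → (Fin n → carrier) → ℝ
  relMap_mem : ∀ {n : ℕ} (R : S.voc.Relations n) (a : Fin n → carrier),
    relMap R a ∈ Set.Icc (0 : ℝ) 1
  funMap_unif : ∀ {n : ℕ} (f : S.voc.Functions n) (ε : Set.Ioo (0 : ℚ) 1)
    (a b : Fin n → carrier),
    (∀ i, dist (a i) (b i) < ((S.funModulus f ε : ℚ) : ℝ)) →
      dist (funMap f a) (funMap f b) ≤ ((ε : ℚ) : ℝ)
  relMap_unif : ∀ {n : ℕ} (R : S.voc.Relations n) (ε : Set.Ioo (0 : ℚ) 1)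
    (a b : Fin n → carrier),
    (∀ i, dist (a i) (b i) < ((S.relModulus R ε : ℚ) : ℝ)) →
      |relMap R a - relMap R b| ≤ ((ε : ℚ) : ℝ)

attribute [instance] MetricStructure.metric MetricStructure.nonempty

/-- Formulas of basic continuous logic whose free variables are among `x₀, …, xₙ₋₁`.
In `ex φ` the quantified variable is the last variable `xₙ` of `φ`. -/
inductive Formula (S : Signature.{u}) : ℕ → Type u
  | dist {n : ℕ} (t₁ t₂ : S.Term n) : Formula S n
  | rel {n k : ℕ} (R : S.voc.Relations k) (t : Fin k → S.Term n) : Formula S n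
  | const {n : ℕ} (r : Set.Icc (0 : ℚ) 1) : Formula S n
  | imp {n : ℕ} (φ ψ : Formula S n) : Formula S n
  | ex {n : ℕ} (φ : Formula S (n + 1)) : Formula S n

/-- Sentences: formulas without free variables. -/
abbrev Sentence (S : Signature.{u}) : Type u := Formula S 0

/-- Theories: sets of sentences. -/
abbrev Theory (S : Signature.{u}) : Type u := Set (Sentence S)

variable {S : Signature.{u}}

/-- The interpretation `t^M[a]` of a term. -/
def MetricStructure.termVal (M : MetricStructure S) {n : ℕ} (a : Fin n → M.carrier) :
    S.Term n → M.carrier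
  | .var i => a i
  | .func f ts => M.funMap f fun i => M.termVal a (ts i)

/-- The Łukasiewicz implication on reals. -/
noncomputable def lukImp (x y : ℝ) : ℝ := min (1 - x + y) 1

/-- The truth value `φ^M[a]`. -/
noncomputable def MetricStructure.val (M : MetricStructure S) :
    {n : ℕ} → Formula S n → (Fin n → M.carrier) → ℝ
  | _, .dist t₁ t₂, a => Dist.dist (M.termVal a t₁) (M.termVal a t₂)
  | _, .rel R t, a => M.relMap R fun i => M.termVal a (t i)
  | _, .const r, _ => ((r : ℚ) : ℝ)
  | _, .imp φ ψ, a => lukImp (M.val φ a) (M.val ψ a)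
  | _, .ex φ, a => ⨆ b : M.carrier, M.val φ (Fin.snoc a b)

/-- Truth values lie in `[0,1]`; in particular every supremum above is one of a nonempty
bounded set. -/
theorem MetricStructure.val_mem (M : MetricStructure S) {n : ℕ} (φ : Formula S n)
    (a : Fin n → M.carrier) : M.val φ a ∈ Set.Icc (0 : ℝ) 1 := by
  induction φ with
  | dist t₁ t₂ => exact ⟨dist_nonneg, M.dist_le_one _ _⟩
  | rel R t => exact M.relMap_mem _ _
  | const r =>
    simp only [MetricStructure.val, Set.mem_Icc]
    exact ⟨by exact_mod_cast r.2.1, by exact_mod_cast r.2.2⟩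
  | imp φ ψ hφ hψ =>
    have h1 := hφ a
    have h2 := hψ a
    simp only [MetricStructure.val, lukImp, Set.mem_Icc] at *
    exact ⟨le_min (by linarith) zero_le_one, min_le_right _ _⟩
  | ex φ h =>
    simp only [MetricStructure.val, Set.mem_Icc]
    exact ⟨Real.iSup_nonneg fun b => (h _).1, ciSup_le fun b => (h _).2⟩

/-- The formula `φ ≥ r`, i.e. `r → φ`, for a rational `r ∈ (0,1)`. -/
def Formula.ge {n : ℕ} (φ : Formula S n) (r : Set.Ioo (0 : ℚ) 1) : Formula S n :=
  .imp (.const ⟨r, r.2.1.le, r.2.2.le⟩) φ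

/-- Prolongs a substitution by a new last variable, which is left fixed. -/
def liftSubst {n m : ℕ} (t : Fin n → S.Term m) : Fin (n + 1) → S.Term (m + 1) :=
  Fin.snoc (α := fun _ => S.Term (m + 1))
    (fun i => (t i).relabel Fin.castSucc) (.var (Fin.last m))

/-- The formula `φ(t₁(ȳ), …, tₙ(ȳ))`. -/
def Formula.subst : {n m : ℕ} → Formula S n → (Fin n → S.Term m) → Formula S m
  | _, _, .dist t₁ t₂, t => .dist (t₁.subst t) (t₂.subst t)
  | _, _, .rel R ts, t => .rel R fun i => (ts i).subst t
  | _, _, .const r, _ => .const r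
  | _, _, .imp φ ψ, t => .imp (φ.subst t) (ψ.subst t)
  | _, _, .ex φ, t => .ex (φ.subst (liftSubst t))

theorem MetricStructure.termVal_subst (M : MetricStructure S) {n m : ℕ} (s : S.Term n)
    (t : Fin n → S.Term m) (a : Fin m → M.carrier) :
    M.termVal a (s.subst t) = M.termVal (fun i => M.termVal a (t i)) s := by
  induction s with
  | var i => rfl
  | func f ts ih =>
    simp only [FirstOrder.Language.Term.subst, MetricStructure.termVal]
    congr 1
    funext i
    exact ih i

theorem MetricStructure.termVal_castSucc (M : MetricStructure S) {n : ℕ} (s : S.Term n)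
    (a : Fin n → M.carrier) (b : M.carrier) :
    M.termVal (Fin.snoc a b) (s.relabel Fin.castSucc) = M.termVal a s := by
  induction s with
  | var i => simp [FirstOrder.Language.Term.relabel, MetricStructure.termVal]
  | func f ts ih =>
    simp only [FirstOrder.Language.Term.relabel, MetricStructure.termVal]
    congr 1
    funext i
    exact ih i

/-- Substitution is computed by evaluating the substituted terms. -/
theorem MetricStructure.val_subst (M : MetricStructure S) {n m : ℕ} (φ : Formula S n)
    (t : Fin n → S.Term m) (a : Fin m → M.carrier) :
    M.val (φ.subst t) a = M.val φ (fun i => M.termVal a (t i)) := by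
  induction φ generalizing m with
  | dist t₁ t₂ => simp only [Formula.subst, MetricStructure.val, M.termVal_subst]
  | rel R ts => simp only [Formula.subst, MetricStructure.val, M.termVal_subst]
  | const r => rfl
  | imp φ ψ hφ hψ => simp only [Formula.subst, MetricStructure.val, hφ, hψ]
  | ex φ h =>
    simp only [Formula.subst, MetricStructure.val, h]
    congr 1
    funext b
    congr 1
    funext i
    refine Fin.lastCases ?_ (fun i => ?_) i
    · simp [liftSubst, MetricStructure.termVal]
    · simp only [liftSubst, Fin.snoc_castSucc]
      exact M.termVal_castSucc _ _ _

/-- The tuple `a` realizes the set of formulas `p(x₀, …, xₙ₋₁)` in `M`. -/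
def MetricStructure.Realizes (M : MetricStructure S) {n : ℕ} (a : Fin n → M.carrier)
    (p : Set (Formula S n)) : Prop :=
  ∀ σ ∈ p, M.val σ a = 1

/-- `M` is a model of `T`. -/
def MetricStructure.IsModel (M : MetricStructure S) (T : Theory S) : Prop :=
  ∀ σ ∈ T, M.val σ Fin.elim0 = 1

/-- `M` omits `p(x₀, …, xₙ₋₁)`: no tuple of `M` realizes `p`. -/
def MetricStructure.Omits (M : MetricStructure S) {n : ℕ} (p : Set (Formula S n)) : Prop :=
  ∀ a : Fin n → M.carrier, ∃ σ ∈ p, M.val σ a < 1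

/-- `T` is satisfied by some `S`-structure. -/
def Theory.IsSatisfiable (T : Theory S) : Prop :=
  ∃ M : MetricStructure S, M.IsModel T

/-- `T ∪ p(x̄)` is satisfiable: `p(x₀, …, xₙ₋₁)` is realized in some model of `T`. -/
def Theory.SatisfiableWith (T : Theory S) {n : ℕ} (p : Set (Formula S n)) : Prop :=
  ∃ M : MetricStructure S, M.IsModel T ∧ ∃ a : Fin n → M.carrier, M.Realizes a p

/-- `T ∪ Γ(x̄) ⊨ p(x̄)`. -/
def Theory.Entails (T : Theory S) {n : ℕ} (Γ p : Set (Formula S n)) : Prop :=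
  ∀ M : MetricStructure S, M.IsModel T →
    ∀ a : Fin n → M.carrier, M.Realizes a Γ → M.Realizes a p

/-- `Φ(x̄)` generates `p(x̄)` over `T`: it is consistent with `T` and entails `p` over `T`. -/
def Theory.Generates (T : Theory S) {n : ℕ} (Φ p : Set (Formula S n)) : Prop :=
  T.SatisfiableWith Φ ∧ T.Entails Φ p

/-- `p(t₁(ȳ), …, tₙ(ȳ))`. -/
def substType {n m : ℕ} (p : Set (Formula S n)) (t : Fin n → S.Term m) : Set (Formula S m) :=
  (fun σ => σ.subst t) '' p

/-- `ω`-principality: for some terms `t̄(ȳ)`, a single formula `φ(ȳ)` generates `p(t̄(ȳ))`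
over `T`, and already `φ(ȳ) ≥ r` entails it for some rational `r ∈ (0,1)`. -/
def Theory.OmegaPrincipal (T : Theory S) {n : ℕ} (p : Set (Formula S n)) : Prop :=
  ∃ (m : ℕ) (t : Fin n → S.Term m) (φ : Formula S m),
    T.Generates {φ} (substType p t) ∧
      ∃ r : Set.Ioo (0 : ℚ) 1, T.Entails {φ.ge r} (substType p t)

/-- `κ`-principality over `T`, for an infinite cardinal `κ`. -/
def Theory.Principal (T : Theory S) (κ : Cardinal.{u}) {n : ℕ} (p : Set (Formula S n)) : Prop :=
  (κ = ℵ₀ ∧ T.OmegaPrincipal p) ∨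
    (ℵ₀ < κ ∧ ∃ Φ : Set (Formula S n), #Φ < κ ∧ T.Generates Φ p)

/-- The `κ`-Omitting Types Property of basic continuous logic. The signature is arbitrary;
only the cardinality of the theory is bounded. The sets `p j` need not be realized in a model
of `T`: one that is not is never principal, and is omitted by every model of `T`. -/
def OmittingTypesProperty (κ : Cardinal.{u}) : Prop :=
  ∀ (S : Signature.{u}) (T : Theory S), #T ≤ κ → T.IsSatisfiable →
    ∀ (J : Type u), #J ≤ κ →
      ∀ (n : J → ℕ) (p : ∀ j, Set (Formula S (n j))),
        (∀ j, ¬ T.Principal κ (p j)) →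
          ∃ M : MetricStructure S, M.IsModel T ∧ ∀ j, M.Omits (p j)

end BasicContinuousLogic

/-!
Proof of the omitting types theorem for basic continuous logic by a Henkin construction of length
`κ`, carried out with models instead of derivations.

Let `ι` be the initial ordinal of `κ`; its elements serve as new constants. A condition is a set of
`Constraint`s, each of which bounds from below the value of a formula at a tuple of closed terms,
and it is `Consistent` if some model of `T` with an interpretation of the constants obeys it.
Constraints are strict inequalities for `κ = ℵ₀` and closed ones for uncountable `κ`. Conditions
with fewer than `κ` elements can be extended in two ways.

* Henkin step (`Theory.Consistent.exists_henkin`): for a fresh constant `b`, the sentence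
  `∃ x φ(u, x) → φ(u, b)` may be required to have value at least `1 - ε`.
* Omission step (`Theory.Consistent.exists_omit`): for a non-principal type `p` and closed terms
  `u`, some `σ ∈ p` may be required to have value less than `1` at `u`. If `κ = ℵ₀`, the condition
  is finite and open, so it has a little slack and amounts to one formula `θ ≥ r`, where the
  constants have become variables; this does not entail `p(u)`. If `κ` is uncountable, the
  existential projections of the finite parts of the condition form a set of fewer than `κ` formulas
  in the variables of `p`, which does not entail `p`; a tuple that satisfies the projections and
  does not realize `p` becomes the value of `u` in an ultrapower.

At limit stages, which occur only for uncountable `κ`, closed constraints are preserved by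
compactness (`Theory.consistent_of_finite`).

The signature may have more than `κ` symbols, so the tasks cannot be listed in advance: only closed
terms and existential subformulas built from symbols in `T` and in the constraints already chosen
are dealt with. There are at most `κ` of these at each stage, and `exists_chain_of_tasks` does the
bookkeeping.

The models obtained along the way have an ultraproduct `N` which obeys all the constraints. The
values of the closed terms over the operation symbols that were used form a subset of `N`, and the
Tarski–Vaught test (`val_restrict`) shows that truth values of the sentences in `T` and of the
chosen formulas `σ` do not change when passing to it. The operation symbols that were not used are given
a constant interpretation. Completeness of the structure is not required, so this is the model.
-/

namespace BasicContinuousLogic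

open Filter Topology

variable {S : Signature.{u}} {ι : Type u}

/-! ### Terms over an arbitrary set of variables -/

/-- The value of a term whose variables come from an arbitrary type; the variables are read as
names of elements, so that terms over `α` play the part of closed terms with constants in `α`. -/
def MetricStructure.eval (M : MetricStructure S) {α : Type*} (c : α → M.carrier) :
    S.voc.Term α → M.carrier
  | .var i => c i
  | .func f ts => M.funMap f fun i => M.eval c (ts i)

theorem MetricStructure.termVal_eq_eval (M : MetricStructure S) {n : ℕ} (a : Fin n → M.carrier)
    (t : S.Term n) : M.termVal a t = M.eval a t := by
  induction t with
  | var i => rfl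
  | func f ts ih => simp only [termVal, eval, ih]

theorem MetricStructure.eval_relabel (M : MetricStructure S) {α β : Type*} (g : α → β)
    (c : β → M.carrier) (t : S.voc.Term α) : M.eval c (t.relabel g) = M.eval (c ∘ g) t := by
  induction t with
  | var i => rfl
  | func f ts ih => simp only [FirstOrder.Language.Term.relabel, eval, ih]

theorem MetricStructure.eval_congr (M : MetricStructure S) {α : Type*} [DecidableEq α]
    {c c' : α → M.carrier} (t : S.voc.Term α) (h : ∀ i ∈ t.varFinset, c i = c' i) :
    M.eval c t = M.eval c' t := by
  induction t with
  | var i => exact h i (by simp [FirstOrder.Language.Term.varFinset])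
  | func f ts ih =>
    simp only [eval]
    congr 1
    funext k
    refine ih k fun i hi => h i ?_
    simp only [FirstOrder.Language.Term.varFinset, Finset.mem_biUnion, Finset.mem_univ, true_and]
    exact ⟨k, hi⟩

/-! ### Ultraproducts -/

section Ultraproduct

variable {I : Type u} (U : Ultrafilter I)

/-- The limit of a real family along an ultrafilter; meaningful for bounded families. -/
noncomputable def ulim (f : I → ℝ) : ℝ := limUnder (U : Filter I) f

theorem tendsto_ulim {f : I → ℝ} (hf : ∀ i, f i ∈ Set.Icc (0 : ℝ) 1) :
    Tendsto f U (𝓝 (ulim U f)) := by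
  obtain ⟨x, -, hx⟩ := (isCompact_Icc (a := (0 : ℝ)) (b := 1)).ultrafilter_le_nhds (U.map f)
    (le_principal_iff.2 (Ultrafilter.mem_map.2 (Filter.univ_mem' hf)))
  exact tendsto_nhds_limUnder ⟨x, hx⟩

theorem ulim_mem {f : I → ℝ} (hf : ∀ i, f i ∈ Set.Icc (0 : ℝ) 1) :
    ulim U f ∈ Set.Icc (0 : ℝ) 1 :=
  isClosed_Icc.mem_of_tendsto (tendsto_ulim U hf) (Eventually.of_forall hf)

variable (M : I → MetricStructure S)

/-- The product of the carriers, which is to carry the pseudometric `lim_U d`. It is kept apart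
from the plain product so that no other metric is found on it. -/
def UltraPre (_U : Ultrafilter I) (M : I → MetricStructure S) : Type u := ∀ i, (M i).carrier

theorem MetricStructure.dist_mem (M : MetricStructure S) (a b : M.carrier) :
    dist a b ∈ Set.Icc (0 : ℝ) 1 := ⟨dist_nonneg, M.dist_le_one a b⟩

noncomputable instance : PseudoMetricSpace (UltraPre U M) where
  dist a b := ulim U fun i => dist (a i) (b i)
  dist_self a := by
    refine tendsto_nhds_unique (tendsto_ulim U fun i => (M i).dist_mem _ _) ?_
    simp
  dist_comm a b := by simp only [dist_comm]
  dist_triangle a b c := by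
    refine le_of_tendsto_of_tendsto' (tendsto_ulim U fun i => (M i).dist_mem _ _)
      ((tendsto_ulim U fun i => (M i).dist_mem _ _).add
        (tendsto_ulim U fun i => (M i).dist_mem _ _)) fun i => dist_triangle _ _ _

instance : Nonempty (UltraPre U M) := ⟨fun i => Classical.arbitrary (M i).carrier⟩

variable {U M}

theorem UltraPre.tendsto_dist (a b : UltraPre U M) :
    Tendsto (fun i => dist (a i) (b i)) U (𝓝 (dist a b)) :=
  tendsto_ulim U fun i => (M i).dist_mem _ _

theorem UltraPre.eventually_dist_lt {n : ℕ} {a b : Fin n → UltraPre U M} {δ : ℝ}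
    (h : ∀ k, dist (a k) (b k) < δ) : ∀ᶠ i in U, ∀ k, dist (a k i) (b k i) < δ :=
  eventually_all.2 fun k => (UltraPre.tendsto_dist (a k) (b k)).eventually_lt_const (h k)

theorem UltraPre.dist_funMap_le {n : ℕ} (f : S.voc.Functions n) (ε : Set.Ioo (0 : ℚ) 1)
    {a b : Fin n → UltraPre U M} (h : ∀ k, dist (a k) (b k) < ((S.funModulus f ε : ℚ) : ℝ)) :
    dist (show UltraPre U M from fun i => (M i).funMap f fun k => a k i)
      (show UltraPre U M from fun i => (M i).funMap f fun k => b k i) ≤ ((ε : ℚ) : ℝ) :=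
  le_of_tendsto (UltraPre.tendsto_dist _ _)
    ((UltraPre.eventually_dist_lt h).mono fun i hi => (M i).funMap_unif f ε _ _ hi)

theorem UltraPre.tendsto_relMap {n : ℕ} (R : S.voc.Relations n) (a : Fin n → UltraPre U M) :
    Tendsto (fun i => (M i).relMap R fun k => a k i) U
      (𝓝 (ulim U fun i => (M i).relMap R fun k => a k i)) :=
  tendsto_ulim U fun i => (M i).relMap_mem _ _

theorem UltraPre.abs_relMap_le {n : ℕ} (R : S.voc.Relations n) (ε : Set.Ioo (0 : ℚ) 1)
    {a b : Fin n → UltraPre U M} (h : ∀ k, dist (a k) (b k) < ((S.relModulus R ε : ℚ) : ℝ)) :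
    |(ulim U fun i => (M i).relMap R fun k => a k i) -
      (ulim U fun i => (M i).relMap R fun k => b k i)| ≤ ((ε : ℚ) : ℝ) :=
  le_of_tendsto ((UltraPre.tendsto_relMap R a).sub (UltraPre.tendsto_relMap R b)).abs
    ((UltraPre.eventually_dist_lt h).mono fun i hi => (M i).relMap_unif R ε _ _ hi)

theorem nonpos_of_forall_rat {x : ℝ} (h : ∀ ε : Set.Ioo (0 : ℚ) 1, x ≤ ((ε : ℚ) : ℝ)) :
    x ≤ 0 := by
  by_contra! hx
  obtain ⟨q, hq0, hq⟩ := exists_rat_btwn (lt_min hx one_pos)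
  have h1 : q < 1 := by exact_mod_cast hq.trans_le (min_le_right _ _)
  exact absurd (h ⟨q, by exact_mod_cast hq0, h1⟩) (not_le.2 (hq.trans_le (min_le_left _ _)))

variable (U M)

/-- A representative of an element of the ultraproduct. -/
noncomputable def ultraOut : SeparationQuotient (UltraPre U M) → UltraPre U M :=
  Function.surjInv SeparationQuotient.surjective_mk

theorem mk_ultraOut (a : SeparationQuotient (UltraPre U M)) :
    SeparationQuotient.mk (ultraOut U M a) = a :=
  Function.surjInv_eq _ a

theorem dist_ultraOut (a b : SeparationQuotient (UltraPre U M)) :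
    dist (ultraOut U M a) (ultraOut U M b) = dist a b := by
  conv_rhs => rw [← mk_ultraOut U M a, ← mk_ultraOut U M b, SeparationQuotient.dist_mk]

theorem dist_ultraOut_mk (a : UltraPre U M) :
    dist (ultraOut U M (SeparationQuotient.mk a)) a = 0 := by
  rw [← SeparationQuotient.dist_mk, mk_ultraOut, dist_self]

/-- The metric ultraproduct: the product of the structures modulo distance `0` for `lim_U d`. -/
noncomputable def ultraproduct : MetricStructure S where
  carrier := SeparationQuotient (UltraPre U M)
  dist_le_one a b := by
    rw [← dist_ultraOut]
    exact (ulim_mem U fun i => (M i).dist_mem _ _).2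
  funMap f a := SeparationQuotient.mk
    (show UltraPre U M from fun i => (M i).funMap f fun k => ultraOut U M (a k) i)
  relMap R a := ulim U fun i => (M i).relMap R fun k => ultraOut U M (a k) i
  relMap_mem R a := ulim_mem U fun i => (M i).relMap_mem _ _
  funMap_unif f ε a b h := by
    rw [SeparationQuotient.dist_mk]
    exact UltraPre.dist_funMap_le f ε (a := fun k => ultraOut U M (a k))
      (b := fun k => ultraOut U M (b k)) fun k => by rw [dist_ultraOut]; exact h k
  relMap_unif R ε a b h :=
    UltraPre.abs_relMap_le R ε (a := fun k => ultraOut U M (a k))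
      (b := fun k => ultraOut U M (b k)) fun k => by rw [dist_ultraOut]; exact h k

/-- The class in the ultraproduct of a choice of elements. -/
noncomputable def ultraMk (a : ∀ i, (M i).carrier) : (ultraproduct U M).carrier :=
  SeparationQuotient.mk (X := UltraPre U M) a

theorem surjective_ultraMk : Function.Surjective (ultraMk U M) :=
  SeparationQuotient.surjective_mk (X := UltraPre U M)

theorem tendsto_dist_ultraMk (a b : ∀ i, (M i).carrier) :
    Tendsto (fun i => dist (a i) (b i)) U (𝓝 (dist (ultraMk U M a) (ultraMk U M b))) :=
  UltraPre.tendsto_dist (U := U) (M := M) a b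

theorem funMap_ultraMk {n : ℕ} (f : S.voc.Functions n) (a : Fin n → ∀ i, (M i).carrier) :
    (ultraproduct U M).funMap f (fun k => ultraMk U M (a k)) =
      ultraMk U M fun i => (M i).funMap f fun k => a k i := by
  refine eq_of_dist_eq_zero (le_antisymm (nonpos_of_forall_rat fun ε => ?_) dist_nonneg)
  refine (SeparationQuotient.dist_mk (α := UltraPre U M) _ _).trans_le ?_
  refine UltraPre.dist_funMap_le f ε (b := a) fun k => ?_
  exact (dist_ultraOut_mk U M (a k)).trans_lt (by exact_mod_cast (S.funModulus f ε).2.1)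

theorem relMap_ultraMk {n : ℕ} (R : S.voc.Relations n) (a : Fin n → ∀ i, (M i).carrier) :
    (ultraproduct U M).relMap R (fun k => ultraMk U M (a k)) =
      ulim U fun i => (M i).relMap R fun k => a k i := by
  refine sub_eq_zero.1 (abs_eq_zero.1
    (le_antisymm (nonpos_of_forall_rat fun ε => ?_) (abs_nonneg _)))
  refine UltraPre.abs_relMap_le (U := U) (M := M) R ε (b := a) fun k => ?_
  exact (dist_ultraOut_mk U M (a k)).trans_lt (by exact_mod_cast (S.relModulus R ε).2.1)

theorem eval_ultraMk {α : Type*} (t : S.voc.Term α) (a : α → ∀ i, (M i).carrier) :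
    (ultraproduct U M).eval (fun k => ultraMk U M (a k)) t =
      ultraMk U M fun i => (M i).eval (fun k => a k i) t := by
  induction t with
  | var i => rfl
  | func f ts ih => simp only [MetricStructure.eval, ih, funMap_ultraMk]

theorem MetricStructure.bddAbove_val (M : MetricStructure S) {n : ℕ} (φ : Formula S (n + 1))
    (a : Fin n → M.carrier) :
    BddAbove (Set.range fun b : M.carrier => M.val φ (Fin.snoc a b)) :=
  ⟨1, by rintro _ ⟨b, rfl⟩; exact (M.val_mem _ _).2⟩

theorem MetricStructure.val_le_ex (M : MetricStructure S) {n : ℕ} (φ : Formula S (n + 1))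
    (a : Fin n → M.carrier) (b : M.carrier) :
    M.val φ (Fin.snoc a b) ≤ M.val (.ex φ) a :=
  le_ciSup (M.bddAbove_val φ a) b

theorem MetricStructure.exists_lt_val (M : MetricStructure S) {n : ℕ} (φ : Formula S (n + 1))
    (a : Fin n → M.carrier) {r : ℝ} (h : r < M.val (.ex φ) a) :
    ∃ b, r < M.val φ (Fin.snoc a b) :=
  exists_lt_of_lt_ciSup h

/-- Łoś's theorem: truth values in the ultraproduct are limits of truth values. -/
theorem tendsto_val_ultraMk {n : ℕ} (φ : Formula S n) (a : Fin n → ∀ i, (M i).carrier) :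
    Tendsto (fun i => (M i).val φ fun k => a k i) U
      (𝓝 ((ultraproduct U M).val φ fun k => ultraMk U M (a k))) := by
  induction φ with
  | dist t₁ t₂ =>
    simp only [MetricStructure.val, MetricStructure.termVal_eq_eval, eval_ultraMk]
    exact tendsto_dist_ultraMk U M _ _
  | rel R t =>
    simp only [MetricStructure.val, MetricStructure.termVal_eq_eval, eval_ultraMk,
      relMap_ultraMk]
    exact tendsto_ulim U fun i => (M i).relMap_mem _ _
  | const r => exact tendsto_const_nhds
  | imp φ ψ hφ hψ =>
    simp only [MetricStructure.val, lukImp]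
    exact ((tendsto_const_nhds.sub (hφ a)).add (hψ a)).min tendsto_const_nhds
  | @ex n φ h =>
    have hs : ∀ b : ∀ i, (M i).carrier,
        Tendsto (fun i => (M i).val φ (Fin.snoc (fun k => a k i) (b i))) U
          (𝓝 ((ultraproduct U M).val φ
            (Fin.snoc (fun k => ultraMk U M (a k)) (ultraMk U M b)))) := by
      intro b
      convert h (Fin.snoc (α := fun _ => ∀ i, (M i).carrier) a b) using 2
      · rename_i i
        congr 1
        funext k
        refine Fin.lastCases ?_ (fun k => ?_) k <;> simp
      · congr 1
        funext k
        refine Fin.lastCases ?_ (fun k => ?_) k <;> simp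
    have hlim := tendsto_ulim U (f := fun i => (M i).val (.ex φ) fun k => a k i)
      fun i => (M i).val_mem _ _
    convert hlim using 2
    refine le_antisymm (ciSup_le fun b => ?_) (le_of_forall_pos_le_add fun ε hε => ?_)
    · obtain ⟨b, rfl⟩ := surjective_ultraMk U M b
      exact le_of_tendsto_of_tendsto' (hs b) hlim fun i => (M i).val_le_ex _ _ _
    · choose b hb using fun i => (M i).exists_lt_val φ (fun k => a k i) (sub_lt_self _ hε)
      have h1 := (ultraproduct U M).val_le_ex φ (fun k => ultraMk U M (a k)) (ultraMk U M b)
      have h2 := le_of_tendsto_of_tendsto' (hlim.sub_const ε) (hs b) fun i => (hb i).le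
      linarith

theorem ultraproduct_isModel {T : Theory S} (h : ∀ i, (M i).IsModel T) :
    (ultraproduct U M).IsModel T := by
  intro σ hσ
  have := tendsto_val_ultraMk U M σ Fin.elim0
  refine tendsto_nhds_unique ?_ (tendsto_const_nhds (x := (1 : ℝ)) (f := (U : Filter I)))
  convert this using 2
  · rename_i i
    rw [← h i σ hσ]
    congr 1
    exact Subsingleton.elim _ _
  · congr 1
    exact Subsingleton.elim _ _

end Ultraproduct

/-! ### Chains of conditions meeting dynamically given tasks -/

theorem mk_iUnion_lt_of_finite {κ : Cardinal.{u}} (hκ : ℵ₀ ≤ κ) {I X : Type u} (hI : #I < κ)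
    {F : I → Set X} (hF : ∀ i, (F i).Finite) : #(⋃ i, F i : Set X) < κ := by
  rcases lt_or_ge (#I) ℵ₀ with h | h
  · have : Finite I := Cardinal.lt_aleph0_iff_finite.1 h
    exact (Cardinal.lt_aleph0_iff_set_finite.2 (Set.finite_iUnion hF)).trans_le hκ
  · refine (mk_iUnion_le_sum_mk.trans (Cardinal.sum_le_sum _ (fun _ => ℵ₀) fun i =>
      (Cardinal.lt_aleph0_iff_set_finite.2 (hF i)).le)).trans_lt ?_
    rw [Cardinal.sum_const']
    exact Cardinal.mul_lt_of_lt hκ hI (h.trans_lt hI)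

/-- A bookkeeping function: every pair is handled at some stage beyond its first entry. -/
theorem exists_bookkeeping {κ : Cardinal.{u}} (hκ : ℵ₀ ≤ κ) {ι : Type u} [LinearOrder ι]
    (hι : #ι = κ) (hlt : ∀ i : ι, #(Set.Iio i) < κ) :
    ∃ g : ι → ι × ι, ∀ p : ι × ι, ∃ i, p.1 < i ∧ g i = p := by
  have h : #ι = #((ι × ι) × ι) := by
    simp only [mk_prod, lift_id, hι, Cardinal.mul_eq_self hκ]
  obtain ⟨e⟩ := Cardinal.eq.1 h
  refine ⟨fun i => (e i).1, fun p => ?_⟩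
  by_contra! hp
  have hsub : ∀ k : ι, e.symm (p, k) ∈ insert p.1 (Set.Iio p.1) := fun k => by
    rcases lt_trichotomy p.1 (e.symm (p, k)) with h | h | h
    · exact absurd (by simp) (hp _ h)
    · exact Or.inl h.symm
    · exact Or.inr h
  have hle : #ι ≤ #(insert p.1 (Set.Iio p.1) : Set ι) :=
    Cardinal.mk_le_of_injective (f := fun k => ⟨_, hsub k⟩) fun k k' hk => by
      simpa using hk
  refine absurd (hle.trans Cardinal.mk_insert_le) (not_le.2 ?_)
  rw [hι]
  exact Cardinal.add_lt_of_lt hκ (hlt _) (one_lt_aleph0.trans_le hκ)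

/-- A construction of length `κ`. The sets `P` of facts that are `Good` enable tasks, and every
task enabled by a small good set can be carried out by adding finitely many facts. Then there is an
increasing chain of small good sets along which every task that is ever enabled is carried out.
Nothing is assumed of limit stages if `κ = ℵ₀`, since there are none. -/
theorem exists_chain_of_tasks {κ : Cardinal.{u}} (hκ : ℵ₀ ≤ κ) {ι : Type u} [LinearOrder ι]
    [WellFoundedLT ι] (hι : #ι = κ) (hlt : ∀ i : ι, #(Set.Iio i) < κ) {X τ : Type u}
    (Good : Set X → Prop) (Task : Set X → Set τ) (Done : τ → Set X → Prop)
    (hempty : Good ∅) (hanti : ∀ P Q, Q ⊆ P → Good P → Good Q)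
    (hlim : ℵ₀ < κ → ∀ P, (∀ Q ⊆ P, Q.Finite → Good Q) → Good P)
    (hmono : Monotone Task) (hdone : ∀ t P Q, P ⊆ Q → Done t P → Done t Q)
    (hcard : ∀ P : Set X, #P < κ → #(Task P) ≤ κ)
    (hstep : ∀ P : Set X, #P < κ → Good P → ∀ t ∈ Task P,
      ∃ F : Set X, F.Finite ∧ Good (P ∪ F) ∧ Done t (P ∪ F)) :
    ∃ P : ι → Set X, Monotone P ∧ (∀ i, Good (P i)) ∧
      ∀ i, ∀ t ∈ Task (P i), ∃ j, Done t (P j) := by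
  classical
  obtain ⟨g, hg⟩ := exists_bookkeeping hκ hι hlt
  have henum : ∀ P : Set X, ∃ e : ι → Option τ, #P < κ → ∀ t ∈ Task P, ∃ i, e i = some t := by
    intro P
    by_cases hP : #P < κ
    · obtain ⟨f⟩ : Nonempty (Task P ↪ ι) := by
        rw [← Cardinal.le_def, hι]
        exact hcard P hP
      refine ⟨fun i => (Function.partialInv f i).map Subtype.val, fun _ t ht => ⟨f ⟨t, ht⟩, ?_⟩⟩
      simp [Function.partialInv_left f.injective]
    · exact ⟨fun _ => none, fun h => absurd h hP⟩
  choose e he using henum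
  have hG : ∀ (P : Set X) (o : Option τ), ∃ F : Set X, F.Finite ∧
      (#P < κ → Good P → Good (P ∪ F) ∧ ∀ t ∈ Task P, o = some t → Done t (P ∪ F)) := by
    intro P o
    by_cases h : #P < κ ∧ Good P ∧ ∃ t ∈ Task P, o = some t
    · obtain ⟨hP, hgood, t, ht, rfl⟩ := h
      obtain ⟨F, hF, h1, h2⟩ := hstep P hP hgood t ht
      exact ⟨F, hF, fun _ _ => ⟨h1, fun t' _ h' => by cases h'; exact h2⟩⟩
    · refine ⟨∅, Set.finite_empty, fun hP hgood => ⟨by simpa using hgood, fun t ht ho => ?_⟩⟩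
      exact absurd ⟨hP, hgood, t, ht, ho⟩ h
  choose G hGfin hG using hG
  obtain ⟨F, hF⟩ : ∃ F : ι → Set X, ∀ i, F i = G (⋃ j : Set.Iio i, F j)
      (if (g i).1 < i then e (⋃ j : Set.Iio (g i).1, F j) (g i).2 else none) := by
    refine ⟨WellFoundedLT.fix fun i rec => G (⋃ j : Set.Iio i, rec j j.2)
      (if h : (g i).1 < i then e (⋃ j : Set.Iio (g i).1, rec j (lt_trans j.2 h)) (g i).2
        else none), fun i => ?_⟩
    rw [WellFoundedLT.fix_eq]
    split_ifs <;> rfl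
  set P : ι → Set X := fun i => ⋃ j : Set.Iio i, F j
  have hFfin : ∀ i, (F i).Finite := fun i => by rw [hF]; exact hGfin _ _
  have hPcard : ∀ i, #(P i) < κ := fun i => mk_iUnion_lt_of_finite hκ (hlt i) fun j => hFfin j
  have hFP : ∀ {i j}, j < i → F j ⊆ P i := fun {i j} h =>
    Set.subset_iUnion (fun j : Set.Iio i => F j) ⟨j, h⟩
  have hPmono : Monotone P := fun i j hij => Set.iUnion_subset fun k => hFP (k.2.trans_le hij)
  have hgood : ∀ i, Good (P i) := by
    intro i
    induction i using WellFoundedLT.induction with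
    | ind i ih =>
      by_cases hmax : ∃ j < i, ∀ k < i, k ≤ j
      · obtain ⟨j, hj, hjmax⟩ := hmax
        refine hanti (P j ∪ F j) _ (Set.iUnion_subset fun k => ?_) ?_
        · rcases (hjmax k k.2).lt_or_eq with h | h
          · exact (hFP h).trans Set.subset_union_left
          · rw [h]; exact Set.subset_union_right
        · rw [hF j]; exact (hG (P j) _ (hPcard j) (ih j hj)).1
      · push Not at hmax
        rcases (Set.Iio i).eq_empty_or_nonempty with h0 | ⟨j0, hj0⟩
        · have : P i = ∅ := by
            rw [← Set.subset_empty_iff]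
            exact Set.iUnion_subset fun k => (Set.eq_empty_iff_forall_notMem.1 h0 k k.2).elim
          rw [this]; exact hempty
        · have hinf : ℵ₀ < κ := by
            refine lt_of_le_of_lt ?_ (hlt i)
            rw [Cardinal.aleph0_le_mk_iff]
            have : Nonempty (Set.Iio i) := ⟨⟨j0, hj0⟩⟩
            have : NoMaxOrder (Set.Iio i) := ⟨fun j => by
              obtain ⟨k, hk, hjk⟩ := hmax j j.2
              exact ⟨⟨k, hk⟩, hjk⟩⟩
            exact NoMaxOrder.infinite
          refine hlim hinf _ fun Q hQ hQfin => ?_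
          have hsub : (hQfin.toFinset : Set X) ⊆ ⋃ j ∈ Set.Iio i, P j := by
            intro x hx
            obtain ⟨j, hxj⟩ := Set.mem_iUnion.1 (hQ (by simpa using hx))
            obtain ⟨k, hk, hjk⟩ := hmax j j.2
            exact Set.mem_biUnion hk (hFP hjk hxj)
          obtain ⟨j, hj, hQj⟩ := DirectedOn.exists_mem_subset_of_finset_subset_biUnion
            (f := P) ⟨j0, hj0⟩ (fun a ha b hb => ⟨max a b, max_lt ha hb,
              hPmono (le_max_left _ _), hPmono (le_max_right _ _)⟩) hsub
          exact hanti _ _ (by simpa using hQj) (ih j hj)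
  refine ⟨P, hPmono, hgood, fun i t ht => ?_⟩
  obtain ⟨k, hk⟩ := he (P i) (hPcard i) t ht
  obtain ⟨j, hij, hj⟩ := hg (i, k)
  obtain ⟨j', hj', -⟩ := hg (j, j)
  refine ⟨j', hdone t (P j ∪ F j) _ (Set.union_subset (hPmono hj'.le) (hFP hj')) ?_⟩
  rw [hF j]
  refine (hG (P j) _ (hPcard j) (hgood j)).2 t (hmono (hPmono hij.le) ht) ?_
  rw [hj, if_pos hij]
  exact hk

/-! ### Definable connectives and the symbols of a formula -/

/-- The negation `φ → 0`. -/
def Formula.neg {n : ℕ} (φ : Formula S n) : Formula S n := .imp φ (.const ⟨0, by simp⟩)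

theorem MetricStructure.val_neg (M : MetricStructure S) {n : ℕ} (φ : Formula S n)
    (a : Fin n → M.carrier) : M.val φ.neg a = 1 - M.val φ a := by
  have := (M.val_mem φ a).1
  simp [Formula.neg, val, lukImp, this]

/-- The conjunction with value `min φ ψ`, obtained from `max φ ψ = ((φ → ψ) → ψ)`. -/
def Formula.inf {n : ℕ} (φ ψ : Formula S n) : Formula S n :=
  (.imp (.imp φ.neg ψ.neg) ψ.neg : Formula S n).neg

theorem MetricStructure.val_inf (M : MetricStructure S) {n : ℕ} (φ ψ : Formula S n)
    (a : Fin n → M.carrier) : M.val (φ.inf ψ) a = min (M.val φ a) (M.val ψ a) := by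
  have h1 := M.val_mem φ a
  have h2 := M.val_mem ψ a
  simp only [Set.mem_Icc] at h1 h2
  rw [Formula.inf, val_neg]
  simp only [val, val_neg, lukImp]
  rcases le_total (M.val φ a) (M.val ψ a) with h | h
  · rw [min_eq_left h, min_eq_left (a := 1 - (1 - M.val φ a) + _) (by linarith),
      min_eq_left (by linarith)]
    ring
  · rw [min_eq_right h, min_eq_right (a := 1 - (1 - M.val φ a) + _) (by linarith),
      min_eq_left (by linarith)]
    ring

theorem exists_finite_conj {m : ℕ} {L : Set (Formula S m)} (hL : L.Finite) :
    ∃ θ : Formula S m, ∀ (M : MetricStructure S) (y : Fin m → M.carrier) (r : ℝ), r ≤ 1 →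
      (r ≤ M.val θ y ↔ ∀ φ ∈ L, r ≤ M.val φ y) := by
  induction L, hL using Set.Finite.induction_on with
  | empty =>
    exact ⟨.const ⟨1, by simp⟩, fun M y r hr => by simpa [MetricStructure.val] using hr⟩
  | @insert φ L _ _ ih =>
    obtain ⟨θ, hθ⟩ := ih
    exact ⟨φ.inf θ, fun M y r hr => by simp [M.val_inf, hθ M y r hr]⟩

/-- A block of existential quantifiers computes a supremum over tuples. -/
theorem exists_ex_block {n : ℕ} : ∀ (m : ℕ) (φ : Formula S (n + m)),
    ∃ χ : Formula S n, ∀ (M : MetricStructure S) (a : Fin n → M.carrier),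
      IsLUB (Set.range fun y : Fin m → M.carrier => M.val φ (Fin.append a y)) (M.val χ a)
  | 0, φ => by
    refine ⟨φ, fun M a => ?_⟩
    have : ∀ y : Fin 0 → M.carrier, M.val φ (Fin.append a y) = M.val φ a := fun y => by
      rw [Subsingleton.elim y Fin.elim0, Fin.append_elim0]
      rfl
    simp [this]
  | m + 1, φ => by
    obtain ⟨χ, hχ⟩ := exists_ex_block m (.ex φ)
    refine ⟨χ, fun M a => ⟨?_, fun r hr => (hχ M a).2 ?_⟩⟩
    · rintro _ ⟨y, rfl⟩
      have h1 := M.val_le_ex (n := n + m) φ (Fin.append a (Fin.init y)) (y (Fin.last m))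
      rw [← Fin.append_snoc, Fin.snoc_init_self] at h1
      exact h1.trans ((hχ M a).1 ⟨Fin.init y, rfl⟩)
    · rintro _ ⟨y, rfl⟩
      refine ciSup_le fun b => hr ⟨Fin.snoc y b, ?_⟩
      simp only [Fin.append_snoc]

/-- The operation symbols of a term. -/
def termFuns {L : FirstOrder.Language.{u, u}} {α : Type*} :
    L.Term α → Set (Σ n, L.Functions n)
  | .var _ => ∅
  | .func f ts => insert ⟨_, f⟩ (⋃ i, termFuns (ts i))

theorem finite_termFuns {L : FirstOrder.Language.{u, u}} {α : Type*} (t : L.Term α) :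
    (termFuns t).Finite := by
  induction t with
  | var i => exact Set.finite_empty
  | func f ts ih => exact (Set.finite_iUnion ih).insert _

/-- The operation symbols of a formula. -/
def Formula.funs : {n : ℕ} → Formula S n → Set (Σ n, S.voc.Functions n)
  | _, .dist t₁ t₂ => termFuns t₁ ∪ termFuns t₂
  | _, .rel _ ts => ⋃ i, termFuns (ts i)
  | _, .const _ => ∅
  | _, .imp φ ψ => φ.funs ∪ ψ.funs
  | _, .ex φ => φ.funs

theorem Formula.finite_funs {n : ℕ} (φ : Formula S n) : φ.funs.Finite := by
  induction φ with
  | dist t₁ t₂ => exact (finite_termFuns _).union (finite_termFuns _)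
  | rel R ts => exact Set.finite_iUnion fun i => finite_termFuns _
  | const r => exact Set.finite_empty
  | imp φ ψ hφ hψ => exact hφ.union hψ
  | ex φ h => exact h

/-- The formulas `φ` for which `∃ x φ` is a subformula. -/
def Formula.exBodies : {n : ℕ} → Formula S n → Set (Σ n, Formula S (n + 1))
  | _, .dist _ _ => ∅
  | _, .rel _ _ => ∅
  | _, .const _ => ∅
  | _, .imp φ ψ => φ.exBodies ∪ ψ.exBodies
  | _, .ex φ => insert ⟨_, φ⟩ φ.exBodies

theorem Formula.finite_exBodies {n : ℕ} (φ : Formula S n) : φ.exBodies.Finite := by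
  induction φ with
  | dist t₁ t₂ => exact Set.finite_empty
  | rel R ts => exact Set.finite_empty
  | const r => exact Set.finite_empty
  | imp φ ψ hφ hψ => exact hφ.union hψ
  | ex φ h => exact h.insert _

/-! ### Constraints on constants -/

/-- The requirement that a formula, evaluated at closed terms with constants in `ι`, has at least
(or more than) a given rational value. -/
structure Constraint (S : Signature.{u}) (ι : Type u) : Type u where
  /-- The number of free variables of the formula. -/
  arity : ℕ
  /-- The formula on whose value there is a requirement. -/
  formula : Formula S arity
  /-- The closed terms at which it is evaluated. -/
  args : Fin arity → S.voc.Term ι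
  /-- The lower bound. -/
  bound : Set.Icc (0 : ℚ) 1

/-- The truth value of the formula of a constraint when the constants are interpreted by `c`. -/
noncomputable def Constraint.value (p : Constraint S ι) (M : MetricStructure S)
    (c : ι → M.carrier) : ℝ :=
  M.val p.formula fun i => M.eval c (p.args i)

/-- Constraints are strict for `κ = ℵ₀`, so that they survive a small loss of truth, and they are
closed for uncountable `κ`, so that they survive limits. -/
def Constraint.Holds (κ : Cardinal.{u}) (p : Constraint S ι) (M : MetricStructure S)
    (c : ι → M.carrier) : Prop :=
  ((p.bound : ℚ) : ℝ) ≤ p.value M c ∧ (κ = ℵ₀ → ((p.bound : ℚ) : ℝ) < p.value M c)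

/-- The set `P` of constraints is consistent with `T`. -/
def Theory.Consistent (κ : Cardinal.{u}) (T : Theory S) (P : Set (Constraint S ι)) : Prop :=
  ∃ M : MetricStructure S, M.IsModel T ∧ ∃ c : ι → M.carrier, ∀ p ∈ P, p.Holds κ M c

theorem Theory.Consistent.anti {κ : Cardinal.{u}} {T : Theory S} {P Q : Set (Constraint S ι)}
    (hQ : Q ⊆ P) (h : T.Consistent κ P) : T.Consistent κ Q := by
  obtain ⟨M, hM, c, hc⟩ := h
  exact ⟨M, hM, c, fun p hp => hc p (hQ hp)⟩

open Classical in
/-- The constants of a constraint. -/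
noncomputable def Constraint.vars (p : Constraint S ι) : Finset ι :=
  Finset.univ.biUnion fun i => (p.args i).varFinset

theorem Constraint.value_congr (p : Constraint S ι) {M : MetricStructure S}
    {c c' : ι → M.carrier} (h : ∀ i ∈ p.vars, c i = c' i) : p.value M c = p.value M c' := by
  classical
  unfold value
  congr 1
  funext k
  refine M.eval_congr _ fun i hi => h i ?_
  simp only [vars, Finset.mem_biUnion, Finset.mem_univ, true_and]
  exact ⟨k, by convert hi⟩

theorem Constraint.holds_congr {κ : Cardinal.{u}} (p : Constraint S ι) {M : MetricStructure S}
    {c c' : ι → M.carrier} (h : ∀ i ∈ p.vars, c i = c' i) : p.Holds κ M c ↔ p.Holds κ M c' := by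
  simp only [Holds, p.value_congr h]

theorem Constraint.value_mem (p : Constraint S ι) (M : MetricStructure S) (c : ι → M.carrier) :
    p.value M c ∈ Set.Icc (0 : ℝ) 1 := M.val_mem _ _

theorem Constraint.tendsto_value (p : Constraint S ι) {I : Type u} (U : Ultrafilter I)
    (M : I → MetricStructure S) (c : ∀ i, ι → (M i).carrier) :
    Tendsto (fun i => p.value (M i) (c i)) U
      (𝓝 (p.value (ultraproduct U M) fun k => ultraMk U M fun i => c i k)) := by
  have := tendsto_val_ultraMk U M p.formula fun k i => (M i).eval (c i) (p.args k)
  simpa only [value, eval_ultraMk U M _ fun k i => c i k] using this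

/-- Compactness for closed constraints. -/
theorem Theory.consistent_of_finite {κ : Cardinal.{u}} (hκ : ℵ₀ < κ) {T : Theory S}
    {P : Set (Constraint S ι)} (h : ∀ Q ⊆ P, Q.Finite → T.Consistent κ Q) :
    T.Consistent κ P := by
  classical
  have h' : ∀ Q : Finset P, ∃ M : MetricStructure S, M.IsModel T ∧ ∃ c : ι → M.carrier,
      ∀ p ∈ Q, p.1.Holds κ M c := fun Q => by
    obtain ⟨M, hM, c, hc⟩ := h (Subtype.val '' (Q : Set P)) (by simp)
      (Q.finite_toSet.image _)
    exact ⟨M, hM, c, fun p hp => hc p ⟨p, hp, rfl⟩⟩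
  choose M hM c hc using h'
  let U : Ultrafilter (Finset P) := Ultrafilter.of atTop
  refine ⟨ultraproduct U M, ultraproduct_isModel U M hM,
    fun k => ultraMk U M fun Q => c Q k, fun p hp =>
    ⟨?_, fun h0 => absurd h0 hκ.ne'⟩⟩
  refine ge_of_tendsto (p.tendsto_value U M c) ?_
  have : ∀ᶠ Q : Finset P in atTop, ({⟨p, hp⟩} : Finset P) ≤ Q := eventually_ge_atTop _
  filter_upwards [Ultrafilter.of_le atTop this] with Q hQ
  exact (hc Q ⟨p, hp⟩ (by simpa using hQ)).1

/-- Finitely many names among the constants can be replaced by variables: `e ∘ g` is the identity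
on `W`. -/
theorem exists_retract [Nonempty ι] (W : Finset ι) :
    ∃ (m : ℕ) (e : Fin m → ι) (g : ι → Fin m), ∀ i ∈ W, e (g i) = i := by
  classical
  obtain ⟨i₀⟩ := ‹Nonempty ι›
  let W' := insert i₀ W
  have hpos : 0 < W'.card := Finset.card_pos.2 ⟨i₀, by simp [W']⟩
  refine ⟨W'.card, fun k => W'.equivFin.symm k,
    fun i => if h : i ∈ W' then W'.equivFin ⟨i, h⟩ else ⟨0, hpos⟩, fun i hi => ?_⟩
  have : i ∈ W' := Finset.mem_insert_of_mem hi
  simp [this]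

/-- Finitely many constraints, with constants replaced by variables, become a single formula. -/
theorem exists_formula_of_finite {Q : Set (Constraint S ι)} (hQ : Q.Finite) {m : ℕ}
    (g : ι → Fin m) : ∃ θ : Formula S m, ∀ (M : MetricStructure S) (y : Fin m → M.carrier)
      (r : ℝ), r ≤ 1 →
        (r ≤ M.val θ y ↔ ∀ p ∈ Q, r ≤ 1 - ((p.bound : ℚ) : ℝ) + p.value M (y ∘ g)) := by
  obtain ⟨θ, hθ⟩ := exists_finite_conj (hQ.image fun p =>
    (.imp (.const p.bound) (p.formula.subst fun i => (p.args i).relabel g) : Formula S m))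
  refine ⟨θ, fun M y r hr => ?_⟩
  rw [hθ M y r hr]
  simp only [Set.forall_mem_image, MetricStructure.val, lukImp, M.val_subst,
    M.termVal_eq_eval, M.eval_relabel, le_min_iff, hr, and_true]
  rfl

/-! ### Extending a consistent set of constraints -/

theorem mk_biUnion_lt_of_finite {κ : Cardinal.{u}} (hκ : ℵ₀ ≤ κ) {X Y : Type u} {P : Set X}
    (hP : #P < κ) {F : X → Set Y} (hF : ∀ x, (F x).Finite) : #(⋃ x ∈ P, F x : Set Y) < κ := by
  rw [Set.biUnion_eq_iUnion]
  exact mk_iUnion_lt_of_finite hκ hP fun x => hF x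

/-- Fewer than `κ` constraints and finitely many terms leave a constant unused. -/
theorem exists_fresh {κ : Cardinal.{u}} (hκ : ℵ₀ ≤ κ) (hι : #ι = κ) {P : Set (Constraint S ι)}
    (hP : #P < κ) (W : Finset ι) : ∃ b : ι, b ∉ W ∧ ∀ p ∈ P, b ∉ p.vars := by
  have h : #((⋃ p ∈ P, (p.vars : Set ι)) ∪ (W : Set ι) : Set ι) < κ :=
    (mk_union_le _ _).trans_lt (add_lt_of_lt hκ
      (mk_biUnion_lt_of_finite hκ hP fun p => p.vars.finite_toSet)
      ((lt_aleph0_iff_set_finite.2 W.finite_toSet).trans_le hκ))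
  obtain ⟨b, hb⟩ : ∃ b, b ∉ (⋃ p ∈ P, (p.vars : Set ι)) ∪ (W : Set ι) := by
    by_contra! hall
    rw [Set.eq_univ_of_forall hall, mk_univ, hι] at h
    exact lt_irrefl _ h
  simp only [Set.mem_union, Set.mem_iUnion, Finset.mem_coe, not_or, not_exists] at hb
  exact ⟨b, hb.2, fun p hp => hb.1 p hp⟩

/-- The formula `∃ x φ → φ`. -/
def Formula.henkin {n : ℕ} (φ : Formula S (n + 1)) : Formula S (n + 1) :=
  .imp ((Formula.ex φ).subst fun i => .var i.castSucc) φ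

theorem MetricStructure.val_henkin (M : MetricStructure S) {n : ℕ} (φ : Formula S (n + 1))
    (a : Fin n → M.carrier) (b : M.carrier) : M.val φ.henkin (Fin.snoc a b) =
      1 - M.val (.ex φ) a + M.val φ (Fin.snoc a b) := by
  have h1 := M.val_le_ex φ a b
  have h2 : (fun i : Fin n => M.termVal (Fin.snoc a b)
      (.var i.castSucc : S.Term (n + 1))) = a := by
    funext i
    simp [termVal]
  have h3 : M.val φ.henkin (Fin.snoc a b) =
      lukImp (M.val (.ex φ) a) (M.val φ (Fin.snoc a b)) := by
    rw [Formula.henkin, val, val_subst, h2]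
  rw [h3, lukImp, min_eq_left (by linarith)]

/-- The constraint saying that the constant `b` is a witness of `∃ x φ(u, x)` up to `ε`. -/
def henkinConstraint {n : ℕ} (φ : Formula S (n + 1)) (u : Fin n → S.voc.Term ι) (b : ι)
    (ε : Set.Ioo (0 : ℚ) 1) : Constraint S ι where
  arity := n + 1
  formula := φ.henkin
  args := Fin.snoc (α := fun _ => S.voc.Term ι) u (.var b)
  bound := ⟨1 - ε, by linarith [ε.2.2], by linarith [ε.2.1]⟩

theorem MetricStructure.eval_snoc (M : MetricStructure S) {n : ℕ} (u : Fin n → S.voc.Term ι)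
    (t : S.voc.Term ι) (c : ι → M.carrier) :
    (fun i => M.eval c (Fin.snoc (α := fun _ => S.voc.Term ι) u t i)) =
      Fin.snoc (α := fun _ => M.carrier) (fun i => M.eval c (u i)) (M.eval c t) := by
  funext i
  refine Fin.lastCases ?_ (fun i => ?_) i <;> simp

theorem value_henkinConstraint {n : ℕ} (φ : Formula S (n + 1)) (u : Fin n → S.voc.Term ι) (b : ι)
    (ε : Set.Ioo (0 : ℚ) 1) (M : MetricStructure S) (c : ι → M.carrier) :
    (henkinConstraint φ u b ε).value M c = 1 - M.val (.ex φ) (fun i => M.eval c (u i)) +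
      M.val φ (Fin.snoc (fun i => M.eval c (u i)) (c b)) := by
  unfold Constraint.value
  simp only [henkinConstraint, M.eval_snoc, MetricStructure.val_henkin, MetricStructure.eval]

theorem Theory.Consistent.exists_henkin {κ : Cardinal.{u}} (hκ : ℵ₀ ≤ κ) (hι : #ι = κ)
    {T : Theory S} {P : Set (Constraint S ι)} (hP : #P < κ) (h : T.Consistent κ P) {n : ℕ}
    (φ : Formula S (n + 1)) (u : Fin n → S.voc.Term ι) (ε : Set.Ioo (0 : ℚ) 1) :
    ∃ b, T.Consistent κ (P ∪ {henkinConstraint φ u b ε}) := by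
  classical
  obtain ⟨M, hM, c, hc⟩ := h
  obtain ⟨b, hbW, hbP⟩ := exists_fresh hκ hι hP (Finset.univ.biUnion fun i => (u i).varFinset)
  have hε : (0 : ℝ) < ((ε : ℚ) : ℝ) := by exact_mod_cast ε.2.1
  obtain ⟨m, hm⟩ := M.exists_lt_val φ (fun i => M.eval c (u i)) (sub_lt_self _ hε)
  have hne : ∀ i, i ≠ b → c i = Function.update c b m i := fun i hi => by
    rw [Function.update_of_ne hi]
  refine ⟨b, M, hM, Function.update c b m, ?_⟩
  rintro p (hp | rfl)
  · exact (p.holds_congr fun i hi => hne i fun h => hbP p hp (h ▸ hi)).1 (hc p hp)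
  · have hu : (fun i => M.eval (Function.update c b m) (u i)) = fun i => M.eval c (u i) := by
      funext k
      refine M.eval_congr _ fun i hi => (hne i fun h => hbW ?_).symm
      simp only [Finset.mem_biUnion, Finset.mem_univ, true_and]
      exact ⟨k, h ▸ hi⟩
    have hlt : ((((henkinConstraint φ u b ε).bound : Set.Icc (0 : ℚ) 1) : ℚ) : ℝ) <
        (henkinConstraint φ u b ε).value M (Function.update c b m) := by
      rw [value_henkinConstraint, hu, Function.update_self]
      simp only [henkinConstraint, Rat.cast_sub, Rat.cast_one]
      linarith
    exact ⟨hlt.le, fun _ => hlt⟩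

/-- The constraint `¬ σ(u) ≥ q`, or `¬ σ(u) > q`, which prevents `u` from realizing a type that
contains `σ` when `q` is positive. -/
def omitConstraint {n : ℕ} (σ : Formula S n) (u : Fin n → S.voc.Term ι) (q : Set.Icc (0 : ℚ) 1) :
    Constraint S ι where
  arity := n
  formula := σ.neg
  args := u
  bound := q

theorem value_omitConstraint {n : ℕ} (σ : Formula S n) (u : Fin n → S.voc.Term ι)
    (q : Set.Icc (0 : ℚ) 1) (M : MetricStructure S) (c : ι → M.carrier) :
    (omitConstraint σ u q).value M c = 1 - M.val σ fun i => M.eval c (u i) :=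
  M.val_neg _ _

/-- It suffices to find a model of `T` and of the constraints in which `u` does not realize `p`. -/
theorem consistent_omit_of_ne_one {κ : Cardinal.{u}} {T : Theory S} {P : Set (Constraint S ι)}
    {n : ℕ} {p : Set (Formula S n)} {u : Fin n → S.voc.Term ι} {M : MetricStructure S}
    (hM : M.IsModel T) {c : ι → M.carrier} (hc : ∀ p ∈ P, p.Holds κ M c) {σ : Formula S n}
    (hσ : σ ∈ p) (hne : M.val σ (fun i => M.eval c (u i)) ≠ 1) :
    ∃ σ ∈ p, ∃ q : Set.Icc (0 : ℚ) 1, 0 < (q : ℚ) ∧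
      T.Consistent κ (P ∪ {omitConstraint σ u q}) := by
  have h01 := M.val_mem σ (fun i => M.eval c (u i))
  obtain ⟨q, hq0, hq⟩ := exists_rat_btwn (sub_pos.2 (lt_of_le_of_ne h01.2 hne))
  have hq1 : (q : ℝ) ≤ 1 := by linarith [h01.1]
  refine ⟨σ, hσ, ⟨q, by exact_mod_cast hq0.le, by exact_mod_cast hq1⟩, by exact_mod_cast hq0,
    M, hM, c, ?_⟩
  rintro r (hr | rfl)
  · exact hc r hr
  · refine ⟨?_, fun _ => ?_⟩ <;> rw [value_omitConstraint]
    · exact hq.le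
    · exact hq

/-- The constants of a finite set of constraints and of a tuple of terms. -/
theorem exists_vars_subset {P : Set (Constraint S ι)} (hP : P.Finite) {n : ℕ}
    (u : Fin n → S.voc.Term ι) : ∃ W : Finset ι, (∀ p ∈ P, p.vars ⊆ W) ∧
      ∀ {M : MetricStructure S} {c c' : ι → M.carrier}, (∀ i ∈ W, c i = c' i) →
        ∀ k, M.eval c (u k) = M.eval c' (u k) := by
  classical
  refine ⟨hP.toFinset.biUnion Constraint.vars ∪ Finset.univ.biUnion fun i => (u i).varFinset,
    fun p hp => ?_, fun h k => MetricStructure.eval_congr _ _ fun i hi => h i ?_⟩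
  · exact (Finset.subset_biUnion_of_mem Constraint.vars (hP.mem_toFinset.2 hp)).trans
      Finset.subset_union_left
  · refine Finset.mem_union_right _ ?_
    simp only [Finset.mem_biUnion, Finset.mem_univ, true_and]
    exact ⟨k, hi⟩

/-- Finitely many strict inequalities hold with a uniform rational margin. -/
theorem exists_margin {X : Type*} {P : Set X} (hP : P.Finite) {f : X → ℝ}
    (hf : ∀ x ∈ P, 0 < f x) : ∃ δ : Set.Ioo (0 : ℚ) 1, ∀ x ∈ P, ((δ : ℚ) : ℝ) ≤ f x := by
  induction P, hP using Set.Finite.induction_on with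
  | empty => exact ⟨⟨1 / 2, by norm_num, by norm_num⟩, by simp⟩
  | @insert x P _ _ ih =>
    obtain ⟨δ, hδ⟩ := ih fun y hy => hf y (Set.mem_insert_of_mem _ hy)
    obtain ⟨q, hq0, hq⟩ := exists_rat_btwn (hf x (Set.mem_insert _ _))
    refine ⟨⟨min δ q, lt_min δ.2.1 (by exact_mod_cast hq0),
      (min_le_left _ _).trans_lt δ.2.2⟩, ?_⟩
    rintro y (rfl | hy)
    · have : ((min (δ : ℚ) q : ℚ) : ℝ) ≤ q := by exact_mod_cast min_le_right _ _
      exact this.trans hq.le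
    · have : ((min (δ : ℚ) q : ℚ) : ℝ) ≤ ((δ : ℚ) : ℝ) := by exact_mod_cast min_le_left _ _
      exact this.trans (hδ y hy)

/-- Raises the bound of a constraint by `δ`, up to `1` at most. -/
def Constraint.raise (p : Constraint S ι) (δ : Set.Ioo (0 : ℚ) 1) : Constraint S ι :=
  { p with bound := ⟨min (p.bound + δ) 1,
      le_min (add_nonneg p.bound.2.1 δ.2.1.le) zero_le_one, min_le_right _ _⟩ }

/-- A type that is not `ω`-principal can be prevented from being realized by given closed terms.
The constraints in force are expressed, with a margin `δ`, by a single formula `θ`; `θ ≥ 1 - δ / 2`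
still implies all of them. -/
theorem Theory.Consistent.exists_omit_of_not_omegaPrincipal [Nonempty ι]
    {T : Theory S} {P : Set (Constraint S ι)} (hP : P.Finite) (h : T.Consistent ℵ₀ P) {n : ℕ}
    {p : Set (Formula S n)} (hp : ¬ T.OmegaPrincipal p) (u : Fin n → S.voc.Term ι) :
    ∃ σ ∈ p, ∃ q : Set.Icc (0 : ℚ) 1, 0 < (q : ℚ) ∧
      T.Consistent ℵ₀ (P ∪ {omitConstraint σ u q}) := by
  obtain ⟨M, hM, c, hc⟩ := h
  obtain ⟨W, hWP, hWu⟩ := exists_vars_subset hP u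
  obtain ⟨m, e, g, heg⟩ := exists_retract W
  obtain ⟨δ, hδ⟩ := exists_margin hP (f := fun p => p.value M c - ((p.bound : ℚ) : ℝ))
    fun p hp => sub_pos.2 ((hc p hp).2 rfl)
  have hδ0 : (0 : ℝ) < ((δ : ℚ) : ℝ) := by exact_mod_cast δ.2.1
  obtain ⟨θ, hθ⟩ := exists_formula_of_finite (hP.image fun p => p.raise δ) g
  have hval : ∀ p ∈ P, p.value M ((c ∘ e) ∘ g) = p.value M c := fun p hp =>
    p.value_congr fun i hi => by simp [heg i (hWP p hp hi)]
  have hbound : ∀ p ∈ P, ((p.bound : ℚ) : ℝ) + ((δ : ℚ) : ℝ) ≤ 1 := fun p hp => by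
    linarith [hδ p hp, (p.value_mem M c).2]
  have hraise : ∀ p ∈ P, ((((p.raise δ).bound : Set.Icc (0 : ℚ) 1) : ℚ) : ℝ) =
      ((p.bound : ℚ) : ℝ) + ((δ : ℚ) : ℝ) := fun p hp => by
    simp [Constraint.raise, hbound p hp]
  have hθ1 : M.val θ (c ∘ e) = 1 := by
    refine le_antisymm (M.val_mem _ _).2 ((hθ M (c ∘ e) 1 le_rfl).2 ?_)
    rintro _ ⟨p, hp, rfl⟩
    have h1 : (p.raise δ).value M ((c ∘ e) ∘ g) = p.value M c := hval p hp
    rw [hraise p hp, h1]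
    linarith [hδ p hp]
  let r : Set.Ioo (0 : ℚ) 1 := ⟨1 - δ / 2, by linarith [δ.2.2], by linarith [δ.2.1]⟩
  have hr : ((r : ℚ) : ℝ) = 1 - ((δ : ℚ) : ℝ) / 2 := by simp [r]
  let t : Fin n → S.Term m := fun i => (u i).relabel g
  have hnot : ¬ T.Entails {θ.ge r} (substType p t) := fun hent => by
    refine hp ⟨m, t, θ, ⟨⟨M, hM, c ∘ e, by simpa [MetricStructure.Realizes] using hθ1⟩,
      fun N hN a ha => hent N hN a ?_⟩, r, hent⟩
    simp only [MetricStructure.Realizes, Set.mem_singleton_iff, forall_eq] at ha ⊢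
    simp only [Formula.ge, MetricStructure.val, lukImp, ha]
    rw [hr]
    exact min_eq_right (by linarith)
  simp only [Theory.Entails, MetricStructure.Realizes, Set.mem_singleton_iff, forall_eq,
    substType, Set.forall_mem_image, not_forall] at hnot
  obtain ⟨N, hN, y, hy, σ, hσ, hne⟩ := hnot
  have hy' : 1 - ((δ : ℚ) : ℝ) / 2 ≤ N.val θ y := by
    simp only [Formula.ge, MetricStructure.val, lukImp] at hy
    have := hy ▸ min_le_left (1 - ((r : ℚ) : ℝ) + N.val θ y) 1
    rw [hr] at this
    linarith
  refine consistent_omit_of_ne_one (c := y ∘ g) hN (fun p hp => ?_) hσ ?_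
  · have h1 := (hθ N y _ (by linarith)).1 hy' _ ⟨p, hp, rfl⟩
    have h2 : (p.raise δ).value N (y ∘ g) = p.value N (y ∘ g) := rfl
    simp only [hraise p hp, h2] at h1
    exact ⟨by linarith, fun _ => by linarith⟩
  · simpa only [N.val_subst, N.termVal_eq_eval, t, N.eval_relabel] using hne

/-- Finitely many closed constraints, together with `x = u`, have an existential projection to the
variables `x`. Value `1` of the projection only gives approximate solutions, since a supremum need
not be attained. -/
theorem exists_projection [Nonempty ι] {Q : Set (Constraint S ι)} (hQ : Q.Finite) {n : ℕ}
    (u : Fin n → S.voc.Term ι) : ∃ χ : Formula S n,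
      (∀ (M : MetricStructure S) (c : ι → M.carrier),
        (∀ q ∈ Q, ((q.bound : ℚ) : ℝ) ≤ q.value M c) → M.val χ (fun k => M.eval c (u k)) = 1) ∧
      ∀ (M : MetricStructure S) (a : Fin n → M.carrier), M.val χ a = 1 → ∀ ε : ℝ, 0 < ε →
        ∃ c : ι → M.carrier, (∀ q ∈ Q, ((q.bound : ℚ) : ℝ) - ε ≤ q.value M c) ∧
          ∀ k, dist (a k) (M.eval c (u k)) ≤ ε := by
  obtain ⟨W, hWQ, hWu⟩ := exists_vars_subset hQ u
  obtain ⟨m, e, g, heg⟩ := exists_retract W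
  obtain ⟨θ, hθ⟩ := exists_formula_of_finite hQ g
  let θ' : Formula S (n + m) := θ.subst fun i => .var (Fin.natAdd n i)
  let D : Fin n → Formula S (n + m) := fun k =>
    (Formula.dist (.var (Fin.castAdd m k)) ((u k).relabel fun i => Fin.natAdd n (g i))).neg
  have hθ' : ∀ (M : MetricStructure S) (a : Fin n → M.carrier) (y : Fin m → M.carrier),
      M.val θ' (Fin.append a y) = M.val θ y := fun M a y => by
    simp [θ', M.val_subst, MetricStructure.termVal]
  have hD : ∀ (M : MetricStructure S) (a : Fin n → M.carrier) (y : Fin m → M.carrier) k,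
      M.val (D k) (Fin.append a y) = 1 - dist (a k) (M.eval (y ∘ g) (u k)) :=
    fun M a y k => by
      have : Fin.append a y ∘ (fun i => Fin.natAdd n (g i)) = y ∘ g := by
        funext i
        simp
      simp [D, M.val_neg, MetricStructure.val, MetricStructure.termVal_eq_eval,
        MetricStructure.eval, M.eval_relabel, this]
  obtain ⟨χ₀, hχ₀⟩ := exists_finite_conj ((Set.finite_range D).insert θ')
  have hχ₀' : ∀ (M : MetricStructure S) (a : Fin n → M.carrier) (y : Fin m → M.carrier) (r : ℝ),
      r ≤ 1 → (r ≤ M.val χ₀ (Fin.append a y) ↔ r ≤ M.val θ y ∧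
        ∀ k, r ≤ 1 - dist (a k) (M.eval (y ∘ g) (u k))) := fun M a y r hr => by
    simp [hχ₀ M _ r hr, hθ', hD]
  obtain ⟨χ, hχ⟩ := exists_ex_block m χ₀
  refine ⟨χ, fun M c hc => ?_, fun M a ha ε hε => ?_⟩
  · have hcW : ∀ i ∈ W, ((c ∘ e) ∘ g) i = c i := fun i hi => by simp [heg i hi]
    refine le_antisymm (M.val_mem _ _).2 (le_trans ?_ ((hχ M _).1 ⟨c ∘ e, rfl⟩))
    refine (hχ₀' M _ _ 1 le_rfl).2 ⟨(hθ M _ 1 le_rfl).2 fun q hq => ?_, fun k => ?_⟩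
    · rw [q.value_congr fun i hi => hcW i (hWQ q hq hi)]
      linarith [hc q hq]
    · rw [hWu hcW k]
      simp
  · have hlt : 1 - ε < M.val χ a := by linarith
    obtain ⟨_, ⟨y, rfl⟩, hy⟩ := (lt_isLUB_iff (hχ M a)).1 hlt
    obtain ⟨h1, h2⟩ := (hχ₀' M a y (1 - ε) (by linarith)).1 hy.le
    refine ⟨y ∘ g, fun q hq => ?_, fun k => by linarith [h2 k]⟩
    linarith [(hθ M y _ (by linarith)).1 h1 q hq]

theorem mk_finset_lt {κ : Cardinal.{u}} (hκ : ℵ₀ < κ) {X : Type u} (h : #X < κ) :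
    #(Finset X) < κ := by
  rcases finite_or_infinite X with hX | hX
  · exact (lt_aleph0_of_finite _).trans hκ
  · rwa [mk_finset_of_infinite]

/-- The case of uncountable `κ`: the constraints in force are expressed by the existential
projections of their finite subsets. A tuple that satisfies all the projections solves the
constraints in an ultrapower. -/
theorem Theory.Consistent.exists_omit_of_uncountable [Nonempty ι] {κ : Cardinal.{u}}
    (hκ : ℵ₀ < κ) {T : Theory S} {P : Set (Constraint S ι)} (hP : #P < κ)
    (h : T.Consistent κ P) {n : ℕ} {p : Set (Formula S n)}
    (hp : ¬ ∃ Φ : Set (Formula S n), #Φ < κ ∧ T.Generates Φ p) (u : Fin n → S.voc.Term ι) :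
    ∃ σ ∈ p, ∃ q : Set.Icc (0 : ℚ) 1, 0 < (q : ℚ) ∧
      T.Consistent κ (P ∪ {omitConstraint σ u q}) := by
  classical
  obtain ⟨M, hM, c, hc⟩ := h
  choose χ hχ1 hχ2 using fun Q : Finset P =>
    exists_projection (Q.finite_toSet.image Subtype.val) u
  have hnot : ¬ T.Entails (Set.range χ) p := fun hent => by
    refine hp ⟨Set.range χ, mk_range_le.trans_lt (mk_finset_lt hκ hP),
      ⟨M, hM, fun k => M.eval c (u k), ?_⟩, hent⟩
    rintro _ ⟨Q, rfl⟩
    refine hχ1 Q M c ?_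
    rintro _ ⟨q, -, rfl⟩
    exact (hc q q.2).1
  simp only [Theory.Entails, MetricStructure.Realizes, Set.forall_mem_range, not_forall] at hnot
  obtain ⟨N, hN, a, ha, σ, hσ, hne⟩ := hnot
  choose d hd1 hd2 using fun i : Finset P × ℕ =>
    hχ2 i.1 N a (ha i.1) (1 / ((i.2 : ℝ) + 1)) (by positivity)
  let U : Ultrafilter (Finset P × ℕ) := Ultrafilter.of atTop
  have hU : (U : Filter (Finset P × ℕ)) ≤ atTop := Ultrafilter.of_le _
  have hε : Tendsto (fun i : Finset P × ℕ => 1 / ((i.2 : ℝ) + 1)) U (𝓝 0) := by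
    refine (tendsto_one_div_add_atTop_nhds_zero_nat.comp ?_).mono_left hU
    rw [← prod_atTop_atTop_eq]
    exact tendsto_snd
  let c' : ι → (ultraproduct U fun _ => N).carrier :=
    fun k => ultraMk U (fun _ => N) fun i => d i k
  have ha' : ∀ k, ultraMk U (fun _ => N) (fun _ => a k) =
      (ultraproduct U fun _ => N).eval c' (u k) := fun k => by
    rw [eval_ultraMk U (fun _ => N) (u k) fun k i => d i k]
    refine eq_of_dist_eq_zero (le_antisymm ?_ dist_nonneg)
    exact le_of_tendsto_of_tendsto' (tendsto_dist_ultraMk U (fun _ => N) _ _) hε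
      fun i => hd2 i k
  refine consistent_omit_of_ne_one (M := ultraproduct U fun _ => N) (c := c')
    (ultraproduct_isModel U _ fun _ => hN)
    (fun q hq => ⟨?_, fun h0 => absurd h0 hκ.ne'⟩) hσ ?_
  · have hq' : ∀ᶠ i : Finset P × ℕ in U, ((q.bound : ℚ) : ℝ) - 1 / ((i.2 : ℝ) + 1) ≤
        q.value N (d i) := by
      have : ∀ᶠ i : Finset P × ℕ in atTop, (({⟨q, hq⟩}, 0) : Finset P × ℕ) ≤ i :=
        eventually_ge_atTop _
      filter_upwards [hU this] with i hi
      exact hd1 i q ⟨⟨q, hq⟩, by simpa using hi.1, rfl⟩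
    have := le_of_tendsto_of_tendsto (tendsto_const_nhds.sub hε)
      (q.tendsto_value U (fun _ => N) d) hq'
    simpa using this
  · simp only [← ha']
    rw [tendsto_nhds_unique (tendsto_val_ultraMk U (fun _ => N) σ fun k _ => a k)
      tendsto_const_nhds]
    exact hne

/-- Any type that is not `κ`-principal can be prevented from being realized by given closed
terms. -/
theorem Theory.Consistent.exists_omit [Nonempty ι] {κ : Cardinal.{u}} (hκ : ℵ₀ ≤ κ)
    {T : Theory S} {P : Set (Constraint S ι)} (hP : #P < κ) (h : T.Consistent κ P) {n : ℕ}
    {p : Set (Formula S n)} (hp : ¬ T.Principal κ p) (u : Fin n → S.voc.Term ι) :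
    ∃ σ ∈ p, ∃ q : Set.Icc (0 : ℚ) 1, 0 < (q : ℚ) ∧
      T.Consistent κ (P ∪ {omitConstraint σ u q}) := by
  simp only [Theory.Principal, not_or, not_and] at hp
  rcases hκ.eq_or_lt with rfl | hκ'
  · exact h.exists_omit_of_not_omegaPrincipal (lt_aleph0_iff_set_finite.1 hP) (hp.1 rfl) u
  · exact h.exists_omit_of_uncountable hκ' hP (hp.2 hκ') u

/-! ### Elementary substructures for part of the vocabulary -/

open Classical in
/-- The structure on a subset `A` closed under the operation symbols in `V`. The remaining operation
symbols are interpreted by a constant, so that they obey their moduli without `A` being closed under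
them. -/
noncomputable def MetricStructure.restrict (N : MetricStructure S) (A : Set N.carrier)
    (V : Set (Σ n, S.voc.Functions n)) (a₀ : A)
    (hA : ∀ (n : ℕ) (f : S.voc.Functions n), ⟨n, f⟩ ∈ V → ∀ a : Fin n → A,
      N.funMap f (fun i => a i) ∈ A) : MetricStructure S where
  carrier := A
  nonempty := ⟨a₀⟩
  dist_le_one a b := N.dist_le_one _ _
  funMap {n} f a := if h : ⟨n, f⟩ ∈ V then ⟨N.funMap f fun i => a i, hA n f h a⟩ else a₀
  relMap R a := N.relMap R fun i => a i
  relMap_mem R a := N.relMap_mem _ _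
  funMap_unif {n} f ε a b h := by
    by_cases hf : (⟨n, f⟩ : Σ n, S.voc.Functions n) ∈ V
    · simp only [hf, dite_true]
      exact N.funMap_unif f ε _ _ h
    · simp only [hf, dite_false, dist_self]
      exact_mod_cast ε.2.1.le
  relMap_unif R ε a b h := N.relMap_unif R ε _ _ h

section Restrict

variable {N : MetricStructure S} {A : Set N.carrier} {V : Set (Σ n, S.voc.Functions n)} {a₀ : A}
  {hA : ∀ (n : ℕ) (f : S.voc.Functions n), ⟨n, f⟩ ∈ V → ∀ a : Fin n → A,
    N.funMap f (fun i => a i) ∈ A}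

theorem coe_termVal_restrict {n : ℕ} (t : S.Term n) (ht : termFuns t ⊆ V) (a : Fin n → A) :
    @Subtype.val N.carrier (· ∈ A) ((N.restrict A V a₀ hA).termVal a t) =
      N.termVal (fun i => (a i).1) t := by
  induction t with
  | var i => rfl
  | func f ts ih =>
    simp only [termFuns, Set.insert_subset_iff, Set.iUnion_subset_iff] at ht
    simp only [MetricStructure.termVal, MetricStructure.restrict, ht.1, dite_true]
    congr 1
    funext k
    exact ih k (ht.2 k)

/-- The Tarski–Vaught test: the substructure is elementary for the formulas whose existential
subformulas have approximate witnesses in it. -/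
theorem val_restrict {H : Set (Σ n, Formula S (n + 1))}
    (hH : ∀ (n : ℕ) (φ : Formula S (n + 1)), ⟨n, φ⟩ ∈ H → ∀ (a : Fin n → A)
      (ε : Set.Ioo (0 : ℚ) 1), ∃ b : A,
        N.val (.ex φ) (fun i => (a i).1) - ((ε : ℚ) : ℝ) ≤
          N.val φ (Fin.snoc (fun i => (a i).1) b.1))
    {n : ℕ} (φ : Formula S n) (hV : φ.funs ⊆ V) (hφ : φ.exBodies ⊆ H) (a : Fin n → A) :
    (N.restrict A V a₀ hA).val φ a = N.val φ fun i => (a i).1 := by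
  induction φ with
  | dist t₁ t₂ =>
    simp only [Formula.funs, Set.union_subset_iff] at hV
    simp only [MetricStructure.val]
    rw [← coe_termVal_restrict (a₀ := a₀) (hA := hA) t₁ hV.1 a,
      ← coe_termVal_restrict (a₀ := a₀) (hA := hA) t₂ hV.2 a]
    rfl
  | rel R ts =>
    simp only [Formula.funs, Set.iUnion_subset_iff] at hV
    simp only [MetricStructure.val, MetricStructure.restrict]
    congr 1
    funext k
    exact coe_termVal_restrict (ts k) (hV k) a
  | const r => rfl
  | imp φ ψ ih₁ ih₂ =>
    simp only [Formula.funs, Formula.exBodies, Set.union_subset_iff] at hV hφ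
    simp only [MetricStructure.val, ih₁ hV.1 hφ.1, ih₂ hV.2 hφ.2]
  | @ex n φ ih =>
    simp only [Formula.funs, Formula.exBodies, Set.insert_subset_iff] at hV hφ
    have hs : ∀ b : A, (N.restrict A V a₀ hA).val φ (Fin.snoc (α := fun _ => A) a b) =
        N.val φ (Fin.snoc (fun i => (a i).1) b.1) := fun b => by
      rw [ih hV hφ.2 (Fin.snoc (α := fun _ => A) a b)]
      congr 1
      funext i
      refine Fin.lastCases ?_ (fun i => ?_) i <;> simp
    refine le_antisymm (ciSup_le fun b => (hs b).trans_le (N.val_le_ex φ _ _)) ?_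
    refine sub_nonpos.1 (nonpos_of_forall_rat fun ε => ?_)
    obtain ⟨b, hb⟩ := hH n φ hφ.1 a ε
    have := (N.restrict A V a₀ hA).val_le_ex φ a b
    have h2 := hs b
    linarith! [this, h2, hb]

end Restrict

/-! ### Counting the tasks -/

theorem mk_biUnion_le_of_finite {κ : Cardinal.{u}} (hκ : ℵ₀ ≤ κ) {X Y : Type u} {P : Set X}
    (hP : #P ≤ κ) {F : X → Set Y} (hF : ∀ x, (F x).Finite) : #(⋃ x ∈ P, F x : Set Y) ≤ κ := by
  rw [Set.biUnion_eq_iUnion]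
  refine (mk_iUnion_le_sum_mk.trans (Cardinal.sum_le_sum _ (fun _ => ℵ₀) fun x =>
    (Cardinal.lt_aleph0_iff_set_finite.2 (hF _)).le)).trans ?_
  rw [Cardinal.sum_const']
  exact (mul_le_mul' hP hκ).trans (Cardinal.mul_eq_self hκ).le

/-- The closed terms with constants in `ι` and operation symbols in `V`. -/
def closedTerms (ι : Type u) (V : Set (Σ n, S.voc.Functions n)) : Set (S.voc.Term ι) :=
  {t | termFuns t ⊆ V}

theorem mk_closedTerms_le {κ : Cardinal.{u}} (hκ : ℵ₀ ≤ κ) (hι : #ι = κ)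
    {V : Set (Σ n, S.voc.Functions n)} (hV : #V ≤ κ) : #(closedTerms ι V) ≤ κ := by
  let L : FirstOrder.Language.{u, u} :=
    ⟨fun n => {f : S.voc.Functions n // ⟨n, f⟩ ∈ V}, fun _ => PEmpty⟩
  let F : L →ᴸ S.voc := ⟨fun _ f => f.1, fun _ r => r.elim⟩
  have hsub : closedTerms ι V ⊆ Set.range (F.onTerm : L.Term ι → S.voc.Term ι) := by
    intro t ht
    induction t with
    | var i => exact ⟨.var i, rfl⟩
    | func f ts ih =>
      simp only [closedTerms, Set.mem_ofPred_eq, termFuns, Set.insert_subset_iff,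
        Set.iUnion_subset_iff] at ht ih
      choose s hs using fun k => ih k (ht.2 k)
      refine ⟨.func (⟨f, ht.1⟩ : L.Functions _) s, ?_⟩
      simp only [FirstOrder.Language.LHom.onTerm, hs, F]
  have hL : #(Σ n, L.Functions n) ≤ κ := by
    refine le_trans (mk_le_of_injective (f := fun x => (⟨⟨x.1, x.2.1⟩, x.2.2⟩ : V)) ?_) hV
    rintro ⟨n, f, hf⟩ ⟨m, g, hg⟩ h
    simp only [Subtype.mk.injEq, Sigma.mk.injEq] at h
    obtain ⟨rfl, h⟩ := h
    cases h
    rfl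
  refine (mk_le_mk_of_subset hsub).trans (mk_range_le.trans
    (FirstOrder.Language.Term.card_le.trans (max_le hκ ?_)))
  rw [mk_sum, lift_id, lift_id, hι]
  exact (add_le_add le_rfl hL).trans (add_eq_self hκ).le

theorem mk_tuples_le {κ : Cardinal.{u}} (hκ : ℵ₀ ≤ κ) {X : Type u} (hX : #X ≤ κ) (n : ℕ) :
    #(Fin n → X) ≤ κ := by
  have : #(Fin n → X) = #X ^ n := by simp
  rw [this]
  exact (pow_le_pow_left' hX n).trans (power_nat_le hκ)

theorem mk_sigma_le {κ : Cardinal.{u}} (hκ : ℵ₀ ≤ κ) {X : Type u} {Y : X → Type u} (hX : #X ≤ κ)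
    (hY : ∀ x, #(Y x) ≤ κ) : #(Σ x, Y x) ≤ κ := by
  rw [mk_sigma]
  refine (Cardinal.sum_le_sum _ (fun _ => κ) hY).trans ?_
  rw [Cardinal.sum_const']
  exact (mul_le_mul' hX le_rfl).trans (Cardinal.mul_eq_self hκ).le

/-- The operation symbols in a theory and a set of constraints. -/
def opSymbols (T : Theory S) (P : Set (Constraint S ι)) : Set (Σ n, S.voc.Functions n) :=
  (⋃ σ ∈ T, σ.funs) ∪ ⋃ p ∈ P, p.formula.funs

/-- The bodies of the existential subformulas of a theory and of a set of constraints. -/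
def allBodies (T : Theory S) (P : Set (Constraint S ι)) : Set (Σ n, Formula S (n + 1)) :=
  (⋃ σ ∈ T, σ.exBodies) ∪ ⋃ p ∈ P, p.formula.exBodies

theorem opSymbols_mono (T : Theory S) : Monotone (opSymbols (ι := ι) T) := fun _ _ h =>
  Set.union_subset_union_right _ (Set.biUnion_subset_biUnion_left h)

theorem allBodies_mono (T : Theory S) : Monotone (allBodies (ι := ι) T) := fun _ _ h =>
  Set.union_subset_union_right _ (Set.biUnion_subset_biUnion_left h)

theorem mk_opSymbols_le {κ : Cardinal.{u}} (hκ : ℵ₀ ≤ κ) {T : Theory S} (hT : #T ≤ κ)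
    {P : Set (Constraint S ι)} (hP : #P ≤ κ) : #(opSymbols T P) ≤ κ :=
  (mk_union_le _ _).trans (add_le_of_le hκ
    (mk_biUnion_le_of_finite hκ hT fun σ => σ.finite_funs)
    (mk_biUnion_le_of_finite hκ hP fun p => p.formula.finite_funs))

theorem mk_allBodies_le {κ : Cardinal.{u}} (hκ : ℵ₀ ≤ κ) {T : Theory S} (hT : #T ≤ κ)
    {P : Set (Constraint S ι)} (hP : #P ≤ κ) : #(allBodies T P) ≤ κ :=
  (mk_union_le _ _).trans (add_le_of_le hκ
    (mk_biUnion_le_of_finite hκ hT fun σ => σ.finite_exBodies)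
    (mk_biUnion_le_of_finite hκ hP fun p => p.formula.finite_exBodies))

/-- A Henkin task: to provide a witness of `∃ x φ(u, x)` up to `ε`. -/
abbrev HenkinTask (S : Signature.{u}) (ι : Type u) : Type u :=
  Σ x : (Σ n, Formula S (n + 1)), (Fin x.1 → S.voc.Term ι) × Set.Ioo (0 : ℚ) 1

/-- An omission task: to prevent `u` from realizing the type with index `j`. -/
abbrev OmitTask (S : Signature.{u}) (ι : Type u) {J : Type u} (n : J → ℕ) : Type u :=
  Σ j, Fin (n j) → S.voc.Term ι

/-- The Henkin tasks that concern existential subformulas and closed terms already in use. -/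
def henkinTasks (T : Theory S) (P : Set (Constraint S ι)) : Set (HenkinTask S ι) :=
  {x | x.1 ∈ allBodies T P ∧ ∀ i, x.2.1 i ∈ closedTerms ι (opSymbols T P)}

/-- The omission tasks that concern closed terms already in use. -/
def omitTasks {J : Type u} (n : J → ℕ) (T : Theory S) (P : Set (Constraint S ι)) :
    Set (OmitTask S ι n) :=
  {y | ∀ i, y.2 i ∈ closedTerms ι (opSymbols T P)}

theorem closedTerms_mono {V W : Set (Σ n, S.voc.Functions n)} (h : V ⊆ W) :
    closedTerms ι V ⊆ closedTerms ι W := fun _ ht => Set.Subset.trans ht h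

theorem henkinTasks_mono (T : Theory S) : Monotone (henkinTasks (ι := ι) T) := fun _ _ h _ hx =>
  ⟨allBodies_mono T h hx.1, fun i => closedTerms_mono (opSymbols_mono T h) (hx.2 i)⟩

theorem omitTasks_mono {J : Type u} (n : J → ℕ) (T : Theory S) :
    Monotone (omitTasks (ι := ι) n T) := fun _ _ h _ hx i =>
  closedTerms_mono (opSymbols_mono T h) (hx i)

theorem mk_henkinTasks_le {κ : Cardinal.{u}} (hκ : ℵ₀ ≤ κ) (hι : #ι = κ) {T : Theory S}
    (hT : #T ≤ κ) {P : Set (Constraint S ι)} (hP : #P ≤ κ) : #(henkinTasks T P) ≤ κ := by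
  have hC := mk_closedTerms_le hκ hι (mk_opSymbols_le hκ hT hP)
  let f : (Σ x : allBodies T P, (Fin x.1.1 → closedTerms ι (opSymbols T P)) ×
      Set.Ioo (0 : ℚ) 1) → HenkinTask S ι := fun z => ⟨z.1.1, fun i => z.2.1 i, z.2.2⟩
  have hsub : henkinTasks T P ⊆ Set.range f := by
    rintro ⟨x, v, ε⟩ ⟨hx, hv⟩
    exact ⟨⟨⟨x, hx⟩, fun i => ⟨v i, hv i⟩, ε⟩, rfl⟩
  refine (mk_le_mk_of_subset hsub).trans (mk_range_le.trans
    (mk_sigma_le hκ (mk_allBodies_le hκ hT hP) fun x => ?_))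
  rw [mk_prod]
  refine mul_le_of_le hκ ?_ ?_
  · simpa using mk_tuples_le hκ hC x.1.1
  · exact (lift_le_aleph0.2 (mk_le_aleph0 (α := Set.Ioo (0 : ℚ) 1))).trans hκ

theorem mk_omitTasks_le {κ : Cardinal.{u}} (hκ : ℵ₀ ≤ κ) (hι : #ι = κ) {J : Type u}
    (hJ : #J ≤ κ) (n : J → ℕ) {T : Theory S} (hT : #T ≤ κ) {P : Set (Constraint S ι)}
    (hP : #P ≤ κ) : #(omitTasks n T P) ≤ κ := by
  have hC := mk_closedTerms_le hκ hι (mk_opSymbols_le hκ hT hP)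
  let f : (Σ j, Fin (n j) → closedTerms ι (opSymbols T P)) → OmitTask S ι n :=
    fun z => ⟨z.1, fun i => z.2 i⟩
  have hsub : omitTasks n T P ⊆ Set.range f := by
    rintro ⟨j, v⟩ hv
    exact ⟨⟨j, fun i => ⟨v i, hv i⟩⟩, rfl⟩
  exact (mk_le_mk_of_subset hsub).trans (mk_range_le.trans
    (mk_sigma_le hκ hJ fun j => mk_tuples_le hκ hC _))

/-! ### Omitting types -/

/-- A chain of consistent sets of constraints in which every Henkin and omission task that concerns
the symbols in use is eventually carried out. -/
theorem exists_constraint_chain {κ : Cardinal.{u}} (hκ : ℵ₀ ≤ κ) [LinearOrder ι]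
    [WellFoundedLT ι] [Nonempty ι] (hι : #ι = κ) (hlt : ∀ i : ι, #(Set.Iio i) < κ)
    {T : Theory S} (hT : #T ≤ κ) (hsat : T.IsSatisfiable) {J : Type u} (hJ : #J ≤ κ) (n : J → ℕ)
    (p : ∀ j, Set (Formula S (n j))) (hp : ∀ j, ¬ T.Principal κ (p j)) :
    ∃ P : ι → Set (Constraint S ι), Monotone P ∧ (∀ i, T.Consistent κ (P i)) ∧
      (∀ i, ∀ x ∈ henkinTasks T (P i), ∃ j b, henkinConstraint x.1.2 x.2.1 b x.2.2 ∈ P j) ∧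
      ∀ i, ∀ x ∈ omitTasks n T (P i), ∃ k, ∃ σ ∈ p x.1, ∃ q : Set.Icc (0 : ℚ) 1, 0 < (q : ℚ) ∧
        omitConstraint σ x.2 q ∈ P k := by
  let Task : Set (Constraint S ι) → Set (HenkinTask S ι ⊕ OmitTask S ι n) := fun P =>
    Sum.inl '' henkinTasks T P ∪ Sum.inr '' omitTasks n T P
  let Done : HenkinTask S ι ⊕ OmitTask S ι n → Set (Constraint S ι) → Prop := fun t P =>
    t.elim (fun x => ∃ b, henkinConstraint x.1.2 x.2.1 b x.2.2 ∈ P)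
      fun x : OmitTask S ι n => ∃ σ ∈ p x.1, ∃ q : Set.Icc (0 : ℚ) 1, 0 < (q : ℚ) ∧
        omitConstraint σ x.2 q ∈ P
  obtain ⟨P, hmono, hcons, hdone⟩ := exists_chain_of_tasks hκ hι hlt (T.Consistent κ) Task Done
    (by
      obtain ⟨M, hM⟩ := hsat
      exact ⟨M, hM, fun _ => Classical.arbitrary _, fun p hp => absurd hp (Set.notMem_empty p)⟩)
    (fun P Q hQ h => h.anti hQ) (fun h P hP => Theory.consistent_of_finite h hP)
    (fun P Q h => Set.union_subset_union (Set.image_mono (henkinTasks_mono T h))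
      (Set.image_mono (omitTasks_mono n T h)))
    (by
      rintro (x | x) P Q h
      · rintro ⟨b, hb⟩
        exact ⟨b, h hb⟩
      · rintro ⟨σ, hσ, q, hq, hmem⟩
        exact ⟨σ, hσ, q, hq, h hmem⟩)
    (fun P hP => (mk_union_le _ _).trans (add_le_of_le hκ
      (mk_image_le.trans (mk_henkinTasks_le hκ hι hT hP.le))
      (mk_image_le.trans (mk_omitTasks_le hκ hι hJ n hT hP.le))))
    (by
      rintro P hP hgood t (⟨x, -, rfl⟩ | ⟨x, -, rfl⟩)
      · obtain ⟨b, hb⟩ := hgood.exists_henkin hκ hι hP x.1.2 x.2.1 x.2.2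
        exact ⟨_, Set.finite_singleton _, hb, b, Or.inr rfl⟩
      · obtain ⟨σ, hσ, q, hq, h⟩ := hgood.exists_omit hκ hP (hp x.1) x.2
        exact ⟨_, Set.finite_singleton _, h, σ, hσ, q, hq, Or.inr rfl⟩)
  exact ⟨P, hmono, hcons, fun i x hx => hdone i (.inl x) (Or.inl ⟨x, hx, rfl⟩),
    fun i x hx => hdone i (.inr x) (Or.inr ⟨x, hx, rfl⟩)⟩

/-- A tuple of closed terms over the union of a chain of sets of symbols is a tuple over one of
them. -/
theorem exists_stage_of_closedTerms [LinearOrder ι] [Nonempty ι]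
    {V : ι → Set (Σ n, S.voc.Functions n)} (hV : Monotone V) {n : ℕ} {u : Fin n → S.voc.Term ι}
    (hu : ∀ k, u k ∈ closedTerms ι (⋃ i, V i)) : ∃ i, ∀ k, u k ∈ closedTerms ι (V i) := by
  have hfin : (⋃ k, termFuns (u k)).Finite := Set.finite_iUnion fun k => finite_termFuns (u k)
  obtain ⟨i, hi⟩ := Directed.exists_mem_subset_of_finset_subset_biUnion
    (f := V) (s := hfin.toFinset) hV.directed_le
    (by simpa using fun k => show termFuns (u k) ⊆ _ from hu k)
  exact ⟨i, fun k => (Set.subset_iUnion _ k).trans (by simpa using hi)⟩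

theorem omitting_types {κ : Cardinal.{u}} (hκ : ℵ₀ ≤ κ) : OmittingTypesProperty κ := by
  intro S T hT hsat J hJ n p hp
  let ι : Type u := κ.ord.ToType
  have hι : #ι = κ := mk_ord_toType κ
  have hlt : ∀ i : ι, #(Set.Iio i) < κ := fun i => by
    simpa [ι] using mk_Iio_lt i
  have : Nonempty ι := mk_ne_zero_iff.1 (by rw [hι]; exact (aleph0_pos.trans_le hκ).ne')
  obtain ⟨P, hmono, hcons, hhenkin, homit⟩ := exists_constraint_chain hκ hι hlt hT hsat hJ n p hp
  choose M hM c hc using hcons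
  let U : Ultrafilter ι := Ultrafilter.of atTop
  let N := ultraproduct U M
  let c' : ι → N.carrier := fun k => ultraMk U M fun i => c i k
  have hN : N.IsModel T := ultraproduct_isModel U M hM
  have hP : ∀ i, ∀ q ∈ P i, ((q.bound : ℚ) : ℝ) ≤ q.value N c' := fun i q hq => by
    refine ge_of_tendsto (q.tendsto_value U M c) ?_
    filter_upwards [Ultrafilter.of_le atTop (eventually_ge_atTop i)] with j hij
    exact (hc j q (hmono hij hq)).1
  let V := ⋃ i, opSymbols T (P i)
  let H := ⋃ i, allBodies T (P i)
  have hVmono : Monotone fun i => opSymbols T (P i) := (opSymbols_mono T).comp hmono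
  have hHmono : Monotone fun i => allBodies T (P i) := (allBodies_mono T).comp hmono
  -- The values of the closed terms in use form the universe of the required model.
  let A : Set N.carrier := N.eval c' '' closedTerms ι V
  have hA : ∀ (n : ℕ) (f : S.voc.Functions n), ⟨n, f⟩ ∈ V → ∀ a : Fin n → A,
      N.funMap f (fun i => (a i).1) ∈ A := fun n f hf a => by
    choose t ht hta using fun i => (a i).2
    refine ⟨.func f t, ?_, ?_⟩
    · exact Set.insert_subset hf (Set.iUnion_subset ht)
    · simp only [MetricStructure.eval, hta]
  have hconst : ∀ k, c' k ∈ A := fun k => ⟨.var k, Set.empty_subset _, rfl⟩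
  have hH : ∀ (n : ℕ) (φ : Formula S (n + 1)), ⟨n, φ⟩ ∈ H → ∀ (a : Fin n → A)
      (ε : Set.Ioo (0 : ℚ) 1), ∃ b : A,
        N.val (.ex φ) (fun i => (a i).1) - ((ε : ℚ) : ℝ) ≤
          N.val φ (Fin.snoc (fun i => (a i).1) b.1) := fun n φ hφ a ε => by
    choose u hu hua using fun i => (a i).2
    obtain ⟨i₁, hi₁⟩ := exists_stage_of_closedTerms hVmono hu
    obtain ⟨i₂, hi₂⟩ := Set.mem_iUnion.1 hφ
    obtain ⟨j, b, hb⟩ := hhenkin (max i₁ i₂) ⟨⟨n, φ⟩, u, ε⟩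
      ⟨hHmono (le_max_right _ _) hi₂, fun k => closedTerms_mono (hVmono (le_max_left _ _)) (hi₁ k)⟩
    refine ⟨⟨c' b, hconst b⟩, ?_⟩
    have h := hP j _ hb
    rw [value_henkinConstraint] at h
    simp only [hua, henkinConstraint, Rat.cast_sub, Rat.cast_one] at h
    linarith
  let a₀ : A := ⟨c' (Classical.arbitrary ι), hconst _⟩
  refine ⟨N.restrict A V a₀ hA, fun τ hτ => ?_, fun j a => ?_⟩
  · have hV : τ.funs ⊆ V := fun s hs =>
      Set.mem_iUnion.2 ⟨Classical.arbitrary ι, Or.inl (Set.mem_biUnion hτ hs)⟩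
    have hB : τ.exBodies ⊆ H := fun s hs =>
      Set.mem_iUnion.2 ⟨Classical.arbitrary ι, Or.inl (Set.mem_biUnion hτ hs)⟩
    have h := val_restrict (a₀ := a₀) (hA := hA) hH τ hV hB Fin.elim0
    rw [← hN τ hτ]
    exact (congrArg _ (Subsingleton.elim _ _)).trans
      (h.trans (congrArg _ (Subsingleton.elim _ _)))
  · choose u hu hua using fun i => (a i : A).2
    obtain ⟨i, hi⟩ := exists_stage_of_closedTerms hVmono hu
    obtain ⟨k, σ, hσ, q, hq, hmem⟩ := homit i ⟨j, u⟩ hi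
    have hV : σ.funs ⊆ V := fun s hs =>
      Set.mem_iUnion.2 ⟨k, Or.inr (Set.mem_biUnion hmem (Or.inl hs))⟩
    have hB : σ.exBodies ⊆ H := fun s hs =>
      Set.mem_iUnion.2 ⟨k, Or.inr (Set.mem_biUnion hmem (Or.inl hs))⟩
    refine ⟨σ, hσ, ?_⟩
    rw [val_restrict (a₀ := a₀) (hA := hA) hH σ hV hB a]
    have h := hP k _ hmem
    rw [value_omitConstraint] at h
    simp only [hua, omitConstraint] at h
    have hq' : (0 : ℝ) < ((q : ℚ) : ℝ) := by exact_mod_cast hq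
    linarith

end BasicContinuousLogic

theorem theorem3 (κ : Cardinal.{u}) (hκ : Cardinal.aleph0 ≤ κ) :
    BasicContinuousLogic.OmittingTypesProperty κ :=
  BasicContinuousLogic.omitting_types hκ
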